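/- Let $d\ge 1$, $\rho(d)=\pi^{d/2}/\Gamma\big(\tfrac{d+2}{2}\big)$, let $t\in\mathbb R$, and let $(\lambda_n)$ be a sequence of nonnegative integers with $\lambda_n/n\to\rho(d)t/2$ as $n\to\infty$ (so $t\ge 0$, and $\lambda_n\le\binom n2$ for all large $n$). Let $\mathcal G(n,\lambda_n)$ be the random geometric graph in which $n$ nodes $X_1,\dots,X_n$ are chosen independently and uniformly at random from $[0,1]^d$ and, independently of the positions, $\lambda_n$ edges are inserted at random among the nodes; that is, the graph is uniform among all simple graphs on the $n$ nodes with exactly $\lambda_n$ edges. Let $D_X$ be its degree distribution: $D_X(r)$ is the proportion of nodes of degree $r$, for $r\in\mathbb Z_+=\{0,1,2,\dots\}$. Then, as $n\to\infty$, $D_X$ satisfies a large deviation principle with speed $n$ on the space $\mathcal P(\mathbb Z_+)$ of probability measures on $\mathbb Z_+$ with the weak topology, with good rate function $$\eta(\delta)=\begin{cases}H(\delta\,\|\,q_{\langle\delta\rangle}) & \text{if }\langle\delta\rangle=\rho(d)t,\\ \infty&\text{otherwise,}\end{cases}$$ where $\langle\delta\rangle=\sum_{r\ge0}r\,\delta(r)\in[0,\infty]$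 is the mean of $\delta$, $q_s$ is the Poisson distribution with mean $s$ ($q_0=\delta_0$ is the unit mass at $0$), and $H(\delta\,\|\,q)=\sum_{r}\delta(r)\log\frac{\delta(r)}{q(r)}$ is relative entropy ($\infty$ if $\delta\not\ll q$). Explicitly, $\eta$ has compact sublevel sets $\{\eta\le a\}$, $a\in[0,\infty)$, and $$\limsup_{n\to\infty}\tfrac1n\log\mathbb P(D_X\in F)\le-\inf_{F}\eta,\qquad \liminf_{n\to\infty}\tfrac1n\log\mathbb P(D_X\in U)\ge-\inf_{U}\eta$$ for every closed $F$ and every open $U$ in $\mathcal P(\mathbb Z_+)$. -/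

import Mathlib

open MeasureTheory ProbabilityTheory Filter Topology
open scoped ENNReal NNReal

noncomputable section

namespace RandomGeometricGraph

/-- Large deviation principle with speed `n` and good rate function `I` on the topological space
`E`, for the random elements `Y n` of `E` defined on `(Ω n, P n)`: the sublevel sets of `I` are
closed and compact, and
`limsup (1/n) log P n (Y n ∈ F) ≤ - inf_F I` for closed `F`,
`liminf (1/n) log P n (Y n ∈ U) ≥ - inf_U I` for open `U`.
Logarithms and infima take values in `[-∞, ∞]`, with `log 0 = -∞` and `inf ∅ = ∞`. -/
structure SatisfiesGoodLDP {Ω : ℕ → Type*} [∀ n, MeasurableSpace (Ω n)]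
    {E : Type*} [TopologicalSpace E]
    (P : (n : ℕ) → Measure (Ω n)) (Y : (n : ℕ) → Ω n → E) (I : E → ℝ≥0∞) : Prop where
  isClosed_sublevel : ∀ a : ℝ≥0, IsClosed {x : E | I x ≤ a}
  isCompact_sublevel : ∀ a : ℝ≥0, IsCompact {x : E | I x ≤ a}
  upper_bound : ∀ F : Set E, IsClosed F →
    limsup (fun n : ℕ => ENNReal.log (P n (Y n ⁻¹' F)) / (n : EReal)) atTop
      ≤ - ((⨅ x ∈ F, I x : ℝ≥0∞) : EReal)
  lower_bound : ∀ U : Set E, IsOpen U →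
    - ((⨅ x ∈ U, I x : ℝ≥0∞) : EReal)
      ≤ liminf (fun n : ℕ => ENNReal.log (P n (Y n ⁻¹' U)) / (n : EReal)) atTop

/-- Realisations of a random geometric graph on `n` nodes in `[0,1]^d`: the positions
`X₁, …, Xₙ` of the nodes, and a simple graph on the set of (labels of the) nodes. -/
abbrev Sample (d n : ℕ) : Type := (Fin n → Fin d → unitInterval) × SimpleGraph (Fin n)

/-- The law of the random geometric graph `𝒢(n, m)` on `[0,1]^d`: the `n` nodes are placed
independently and uniformly (Lebesgue measure) in `[0,1]^d`, and, whatever the positions, the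
graph is uniform among all simple graphs on the nodes that have exactly `m` edges, i.e. `m` edges
are drawn at random without replacement among the `n.choose 2` pairs of nodes.
(There is no such graph if `m > n.choose 2`, and then this is the zero measure.) -/
def law (d n m : ℕ) : Measure (Sample d n) :=
  (volume : Measure (Fin n → Fin d → unitInterval)).prod
    (uniformOn {G : SimpleGraph (Fin n) | G.edgeSet.ncard = m})

/-- `(1/n) ∑_v δ_{deg v}`. -/
def degreeMeasure {n : ℕ} (G : SimpleGraph (Fin n)) : Measure ℕ :=
  (n : ℝ≥0∞)⁻¹ • ∑ v : Fin n, Measure.dirac (G.neighborSet v).ncard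

lemma isProbabilityMeasure_degreeMeasure {n : ℕ} (hn : n ≠ 0) (G : SimpleGraph (Fin n)) :
    IsProbabilityMeasure (degreeMeasure G) := by
  constructor
  simp only [degreeMeasure, Measure.smul_apply, Measure.finsetSum_apply, measure_univ,
    Finset.sum_const, Finset.card_univ, Fintype.card_fin, smul_eq_mul, nsmul_eq_mul, mul_one]
  exact ENNReal.inv_mul_cancel (by exact_mod_cast hn) (ENNReal.natCast_ne_top n)

open Classical in
/-- The degree distribution `D_X`: `D_X(r)` is the proportion of nodes of degree `r`.
(A graph without nodes has none; the value `δ_0` for `n = 0` is a convention.) -/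
def degreeDistribution {d n : ℕ} (X : Sample d n) : ProbabilityMeasure ℕ :=
  if hn : n ≠ 0 then ⟨degreeMeasure X.2, isProbabilityMeasure_degreeMeasure hn X.2⟩
  else ⟨Measure.dirac 0, inferInstance⟩

/-- The mean `⟨δ⟩ = ∑_k k δ(k) ∈ [0, ∞]`. -/
def mean (δ : ProbabilityMeasure ℕ) : ℝ≥0∞ := ∑' k : ℕ, (k : ℝ≥0∞) * (δ : Measure ℕ) {k}

/-- `ρ(d) = π^{d/2} / Γ((d+2)/2)`. -/
def rho (d : ℕ) : ℝ := Real.pi ^ ((d : ℝ) / 2) / Real.Gamma (((d : ℝ) + 2) / 2)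

open Classical in
/-- `δ ↦ H(δ ‖ q_{⟨δ⟩})` if `⟨δ⟩ = c`, and `∞` otherwise, where `H` is relative entropy and `q_s`
is the Poisson distribution with mean `s`. -/
def rate (c : ℝ) (δ : ProbabilityMeasure ℕ) : ℝ≥0∞ :=
  if mean δ ≠ ∞ ∧ (mean δ).toReal = c then
    InformationTheory.klDiv (δ : Measure ℕ) (poissonMeasure (mean δ).toNNReal)
  else ∞

end RandomGeometricGraph

end

/-! The positions play no role: only the uniform graph with `m = lam n` edges matters, and `2m/n → c
= ρ(d)t`. Ordering and orienting its edges turns a graph into a word of `2m` letters in the `n`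
nodes, each graph giving `m! 2^m` words without loops or repeated edges, and the degrees become
letter counts (`card_graphs_mul`). Without the simplicity constraint the letter counts of a uniform
word are multinomial, that is, independent Poisson variables of mean `c` conditioned on having sum
`2m`. So Sanov's theorem for Poisson variables is the model, and the constraint on the mean comes
from the fixed number of edges.

Upper bound. Dropping simplicity costs only a subexponential factor, because `2^m` times the falling
factorial of `n.choose 2` is `n^(2m)` up to such a factor. A type class of relative entropy at least
`h` has Poisson probability at most `e^(-nh)` (`sum_prod_pois_le`), and the number of types is
subexponential by a comparison with the generating function of partitions
(`card_image_empirical_mul_le`). This bounds the probability by relative entropy to the fixed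
Poisson law, on distributions of mean exactly `2m/n`. The superexponential Poisson tail makes first
moments uniformly integrable on entropy sublevel sets. These are therefore compact, the mean is
continuous on them, and a mean close to `c` is as good as a mean equal to `c` (`exists_relEnt_gt`).
The same facts give goodness of the rate function.

Lower bound. A distribution of mean `c` and finite entropy is approximated, without raising the cost
noticeably, by one of mean exactly `c` supported on an initial interval and positive there
(`exists_mass_pos`, `exists_finite_support`), then by integer profiles `k` with exact sums
(`exists_profile`). Two multinomial coefficients count the words with profile `k`, and Stirling's
formula gives their rate. Degrees are now bounded, so by averaging over permutations of the letters
at least half of these words have a bounded number of loops and repeated edges. Replacing the bad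
edges yields simple words at the price of a polynomial factor and of boundedly many changed degrees
(`factorial_mul_factorial_le`).

If `c = 0`, the rate is finite only at the unit mass at `0`, and the proportion of nodes of positive
degree is at most `2m/n → 0` surely. -/

namespace RandomGeometricGraph

/-! ### Probability measures on `ℕ` and their masses -/

/-- The mass that a probability measure on `ℕ` gives to the point `r`. -/
noncomputable def mass (δ : ProbabilityMeasure ℕ) (r : ℕ) : ℝ := (δ : Measure ℕ).real {r}

lemma mass_nonneg (δ : ProbabilityMeasure ℕ) (r : ℕ) : 0 ≤ mass δ r := measureReal_nonneg

lemma ofReal_mass (δ : ProbabilityMeasure ℕ) (r : ℕ) :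
    ENNReal.ofReal (mass δ r) = (δ : Measure ℕ) {r} := by
  simp [mass, measureReal_def]

lemma hasSum_mass (δ : ProbabilityMeasure ℕ) : HasSum (mass δ) 1 := by
  have h1 : ∑' r, ENNReal.ofReal (mass δ r) = 1 := by
    simp_rw [ofReal_mass]
    have := MeasureTheory.Measure.tsum_indicator_apply_singleton (δ : Measure ℕ) Set.univ
      MeasurableSet.univ
    simpa using this
  have hs : Summable (mass δ) := by
    have := ENNReal.summable_toReal (f := fun r => ENNReal.ofReal (mass δ r)) (by simp [h1])
    simpa [ENNReal.toReal_ofReal (mass_nonneg δ _)] using this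
  have h2 := ENNReal.ofReal_tsum_of_nonneg (mass_nonneg δ) hs
  rw [h1] at h2
  have : ∑' r, mass δ r = 1 := by
    have := congrArg ENNReal.toReal h2
    rwa [ENNReal.toReal_ofReal (tsum_nonneg (mass_nonneg δ)), ENNReal.toReal_one] at this
  exact this ▸ hs.hasSum

lemma mass_le_one (δ : ProbabilityMeasure ℕ) (r : ℕ) : mass δ r ≤ 1 := by
  exact measureReal_le_one

lemma ext_mass {δ δ' : ProbabilityMeasure ℕ} (h : ∀ r, mass δ r = mass δ' r) : δ = δ' := by
  apply Subtype.ext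
  apply Measure.ext_of_singleton
  intro r
  have := ofReal_mass δ r
  rw [h r, ofReal_mass δ' r] at this
  exact this.symm

/-- The probability measure on `ℕ` with given masses. -/
noncomputable def ofMass (x : ℕ → ℝ) (h0 : ∀ r, 0 ≤ x r) (h1 : HasSum x 1) :
    ProbabilityMeasure ℕ :=
  ⟨Measure.sum (fun r => ENNReal.ofReal (x r) • Measure.dirac r),
    h1.isProbabilityMeasure_sum_dirac h0⟩

@[simp] lemma mass_ofMass (x : ℕ → ℝ) (h0 : ∀ r, 0 ≤ x r) (h1 : HasSum x 1) (r : ℕ) :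
    mass (ofMass x h0 h1) r = x r := by
  have : (ofMass x h0 h1 : Measure ℕ) {r} = ENNReal.ofReal (x r) :=
    Measure.sum_smul_dirac_singleton
  rw [mass, measureReal_def, this, ENNReal.toReal_ofReal (h0 r)]

lemma continuous_mass (r : ℕ) : Continuous (fun δ : ProbabilityMeasure ℕ => mass δ r) := by
  rw [continuous_iff_continuousAt]
  intro δ
  have h := ProbabilityMeasure.tendsto_measure_of_isClopen_of_tendsto (E := {r})
    (tendsto_id (α := ProbabilityMeasure ℕ) (x := 𝓝 δ)) (isClopen_discrete _)
  have := (NNReal.continuous_coe.tendsto _).comp h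
  simpa [ContinuousAt, mass, Function.comp_def] using this

/-- Convergence of the masses implies weak convergence. -/
lemma tendsto_of_tendsto_mass {ι : Type*} {L : Filter ι} [L.IsCountablyGenerated]
    {μ : ι → ProbabilityMeasure ℕ} {δ : ProbabilityMeasure ℕ}
    (h : ∀ r, Tendsto (fun i => mass (μ i) r) L (𝓝 (mass δ r))) : Tendsto μ L (𝓝 δ) := by
  -- Portmanteau: lower bounds on open sets suffice, and these follow from finite partial sums as in
  -- Fatou's lemma. No mass can escape, since the limit already has total mass 1.
  refine tendsto_of_forall_isOpen_le_liminf' fun G _ => ?_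
  refine le_of_forall_lt fun b hb => ?_
  have hG : (δ : Measure ℕ) G = ∑' r, G.indicator (fun r => (δ : Measure ℕ) {r}) r :=
    (Measure.tsum_indicator_apply_singleton _ _ (MeasurableSet.of_discrete)).symm
  rw [hG, ENNReal.tsum_eq_iSup_sum] at hb
  obtain ⟨s, hs⟩ := lt_iSup_iff.1 hb
  have hlim : Tendsto (fun i => ∑ r ∈ s, G.indicator (fun r => (μ i : Measure ℕ) {r}) r) L
      (𝓝 (∑ r ∈ s, G.indicator (fun r => (δ : Measure ℕ) {r}) r)) := by
    refine tendsto_finsetSum _ fun r _ => ?_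
    by_cases hr : r ∈ G
    · simp only [Set.indicator_of_mem hr, ← ofReal_mass]
      exact ENNReal.tendsto_ofReal (h r)
    · simp only [Set.indicator_of_notMem hr]
      exact tendsto_const_nhds
  obtain ⟨b', hb', hb''⟩ := exists_between hs
  refine hb'.trans_le (le_liminf_of_le (by isBoundedDefault) ?_)
  filter_upwards [hlim.eventually (lt_mem_nhds hb'')] with i hi
  refine hi.le.trans ?_
  rw [← Measure.tsum_indicator_apply_singleton _ G (MeasurableSet.of_discrete)]
  exact ENNReal.sum_le_tsum s

/-- Identifies the weak topology with pointwise convergence of masses, so that neighbourhoods can be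
described by finitely many of them. -/
lemma isInducing_mass : IsInducing mass := by
  refine isInducing_iff_nhds.2 fun δ => le_antisymm ?_ ?_
  · rw [← map_le_iff_le_comap]
    exact tendsto_pi_nhds.2 fun r => (continuous_mass r).tendsto δ
  · refine tendsto_of_tendsto_mass (L := comap mass (𝓝 (mass δ))) (μ := id) fun r => ?_
    exact tendsto_pi_nhds.1 tendsto_comap r

lemma exists_forall_abs_mass_sub_lt {U : Set (ProbabilityMeasure ℕ)} {δ : ProbabilityMeasure ℕ}
    (hU : U ∈ 𝓝 δ) : ∃ ε > 0, ∃ s : Finset ℕ, ∀ δ' : ProbabilityMeasure ℕ,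
      (∀ r ∈ s, |mass δ' r - mass δ r| < ε) → δ' ∈ U := by
  rw [isInducing_mass.nhds_eq_comap, mem_comap] at hU
  obtain ⟨t, ht, htU⟩ := hU
  rw [nhds_pi, Filter.mem_pi] at ht
  obtain ⟨I, hI, V, hV, hVt⟩ := ht
  have hr : ∀ r, ∃ ε > 0, Metric.ball (mass δ r) ε ⊆ V r := fun r => Metric.mem_nhds_iff.1 (hV r)
  choose e he heV using hr
  obtain ⟨ε, hε, hεe⟩ : ∃ ε > 0, ∀ r ∈ hI.toFinset, ε ≤ e r := by
    rcases hI.toFinset.eq_empty_or_nonempty with h | h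
    · exact ⟨1, one_pos, by simp [h]⟩
    · obtain ⟨r, hr, hr'⟩ := hI.toFinset.exists_min_image e h
      exact ⟨e r, he r, hr'⟩
  refine ⟨ε, hε, hI.toFinset, fun δ' h => htU (hVt fun r hr => heV r ?_)⟩
  rw [Metric.mem_ball, Real.dist_eq]
  exact (h r (by simpa using hr)).trans_le (hεe r (by simpa using hr))

lemma mean_eq (δ : ProbabilityMeasure ℕ) :
    mean δ = ∑' r : ℕ, ENNReal.ofReal (r * mass δ r) := by
  refine tsum_congr fun r => ?_
  rw [ENNReal.ofReal_mul (by positivity), ofReal_mass, ENNReal.ofReal_natCast]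

/-! ### Relative entropy with respect to a Poisson distribution -/

/-- The masses of the Poisson distribution with mean `c`. -/
noncomputable def pois (c : ℝ) (r : ℕ) : ℝ := Real.exp (-c) * c ^ r / r.factorial

lemma pois_pos {c : ℝ} (hc : 0 < c) (r : ℕ) : 0 < pois c r := by
  unfold pois; positivity

lemma hasSum_pois (c : ℝ) : HasSum (pois c) 1 := by
  unfold pois
  have h := (NormedSpace.expSeries_div_hasSum_exp (c : ℝ)).mul_left (Real.exp (-c))
  simp_rw [mul_div_assoc]
  rwa [← Real.exp_eq_exp_ℝ, ← Real.exp_add, neg_add_cancel, Real.exp_zero] at h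

lemma hasSum_pois_mul_exp (c l : ℝ) :
    HasSum (fun r : ℕ => pois c r * Real.exp (l * r)) (Real.exp (-c) * Real.exp (c * Real.exp l)) := by
  have h := (NormedSpace.expSeries_div_hasSum_exp (c * Real.exp l)).mul_left (Real.exp (-c))
  rw [← Real.exp_eq_exp_ℝ] at h
  refine h.congr_fun fun r => ?_
  rw [mul_comm l, Real.exp_nat_mul, pois, mul_pow]
  ring

lemma log_pois {c : ℝ} (hc : 0 < c) (r : ℕ) :
    Real.log (pois c r) = -c + r * Real.log c - Real.log r.factorial := by
  unfold pois
  rw [Real.log_div (by positivity) (by positivity), Real.log_mul (by positivity) (by positivity),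
    Real.log_exp, Real.log_pow]

lemma hasSum_mul_pois (c : ℝ) : HasSum (fun r : ℕ => r * pois c r) c := by
  rw [← hasSum_nat_add_iff' 1]
  have h := (hasSum_pois c).mul_left c
  simp only [Finset.range_one, Finset.sum_singleton, Nat.cast_zero, zero_mul, sub_zero]
  rw [mul_one] at h
  refine h.congr_fun fun r => ?_
  unfold pois
  rw [Nat.factorial_succ]
  push_cast
  field_simp
  ring

open InformationTheory in
/-- The `r`-th term of the relative entropy with respect to the Poisson distribution. -/
noncomputable def entTerm (c : ℝ) (r : ℕ) (x : ℝ) : ℝ := pois c r * klFun (x / pois c r)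

lemma continuous_entTerm (c : ℝ) (r : ℕ) : Continuous (entTerm c r) := by
  unfold entTerm
  have := InformationTheory.continuous_klFun
  fun_prop

lemma entTerm_nonneg {c : ℝ} (hc : 0 < c) (r : ℕ) {x : ℝ} (hx : 0 ≤ x) : 0 ≤ entTerm c r x :=
  mul_nonneg (pois_pos hc r).le (InformationTheory.klFun_nonneg (div_nonneg hx (pois_pos hc r).le))

/-- The correction `- x + pois c r` makes each term nonnegative and sums to zero over a probability
measure. -/
lemma entTerm_eq {c : ℝ} (hc : 0 < c) (r : ℕ) (x : ℝ) :
    entTerm c r x = x * Real.log (x / pois c r) - x + pois c r := by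
  have := (pois_pos hc r).ne'
  unfold entTerm
  rw [InformationTheory.klFun_apply]
  field_simp
  ring

/-- Young's inequality. -/
lemma mul_le_entTerm_add {c : ℝ} (hc : 0 < c) (r : ℕ) {x : ℝ} (hx : 0 ≤ x) (s : ℝ) :
    s * x ≤ entTerm c r x + pois c r * (Real.exp s - 1) := by
  have hq := pois_pos hc r
  rw [entTerm_eq hc]
  rcases hx.eq_or_lt with rfl | hx
  · simp only [mul_zero, zero_mul, sub_zero, zero_add]
    nlinarith [Real.exp_pos s]
  -- `1 + u ≤ e^u` at `u = s - log (x / q)`, to be multiplied by `x`.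
  have h := Real.add_one_le_exp (s - Real.log (x / pois c r))
  rw [Real.exp_sub, Real.exp_log (by positivity)] at h
  have h2 := mul_le_mul_of_nonneg_left h hx.le
  have h3 : x * (Real.exp s / (x / pois c r)) = pois c r * Real.exp s := by field_simp
  rw [h3] at h2
  linarith

/-- A Poisson law of positive mean charges every point, so absolute continuity is automatic and the
density at a point is the ratio of the masses. -/
lemma klDiv_poissonMeasure {c : ℝ≥0} (hc : 0 < c) (δ : ProbabilityMeasure ℕ) :
    InformationTheory.klDiv (δ : Measure ℕ) (poissonMeasure c)
      = ∑' r, ENNReal.ofReal (entTerm c r (mass δ r)) := by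
  have hpos : ∀ r, (poissonMeasure c) {r} = ENNReal.ofReal (pois c r) := fun r => by
    rw [poissonMeasure_singleton]; rfl
  have hq : ∀ r, 0 < pois c r := pois_pos (by exact_mod_cast hc)
  have hne : ∀ r, (poissonMeasure c) {r} ≠ 0 := fun r => by simp [hpos, hq r]
  have hac : (δ : Measure ℕ) ≪ poissonMeasure c := by
    intro s hs
    have : s = ∅ := by
      by_contra hne'
      obtain ⟨r, hr⟩ := Set.nonempty_iff_ne_empty.2 hne'
      exact hne r (measure_mono_null (Set.singleton_subset_iff.2 hr) hs)
    simp [this]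
  rw [InformationTheory.klDiv_eq_lintegral_klFun_of_ac hac, lintegral_countable']
  refine tsum_congr fun r => ?_
  have h1 : (δ : Measure ℕ).rnDeriv (poissonMeasure c) r * (poissonMeasure c) {r}
      = (δ : Measure ℕ) {r} := by
    have := Measure.setLIntegral_rnDeriv hac {r}
    rwa [lintegral_singleton] at this
  have h2 : ((δ : Measure ℕ).rnDeriv (poissonMeasure c) r).toReal = mass δ r / pois c r := by
    rw [eq_div_iff (hq r).ne', mass, measureReal_def, ← h1, ENNReal.toReal_mul, hpos,
      ENNReal.toReal_ofReal (hq r).le]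
  rw [h2, hpos, entTerm, mul_comm, ENNReal.ofReal_mul (hq r).le]

/-- Relative entropy with respect to the Poisson distribution with mean `c`. -/
noncomputable def relEnt (c : ℝ) (δ : ProbabilityMeasure ℕ) : ℝ≥0∞ :=
  ∑' r, ENNReal.ofReal (entTerm c r (mass δ r))

/-- The mean as a real number. -/
noncomputable def realMean (δ : ProbabilityMeasure ℕ) : ℝ := ∑' r : ℕ, r * mass δ r

lemma lowerSemicontinuous_relEnt (c : ℝ) : LowerSemicontinuous (relEnt c) := by
  refine lowerSemicontinuous_tsum fun r => Continuous.lowerSemicontinuous ?_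
  exact ENNReal.continuous_ofReal.comp ((continuous_entTerm c r).comp (continuous_mass r))

lemma summable_entTerm {c : ℝ} (hc : 0 < c) {δ : ProbabilityMeasure ℕ} (h : relEnt c δ ≠ ∞) :
    Summable (fun r => entTerm c r (mass δ r)) := by
  have := ENNReal.summable_toReal h
  simpa [ENNReal.toReal_ofReal (entTerm_nonneg hc _ (mass_nonneg δ _))] using this

lemma relEnt_eq_ofReal {c : ℝ} (hc : 0 < c) {δ : ProbabilityMeasure ℕ} (h : relEnt c δ ≠ ∞) :
    relEnt c δ = ENNReal.ofReal (∑' r, entTerm c r (mass δ r)) :=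
  (ENNReal.ofReal_tsum_of_nonneg (fun _ => entTerm_nonneg hc _ (mass_nonneg δ _))
    (summable_entTerm hc h)).symm

/-- Young's inequality with slope `r` at the point `r`: the Poisson law has exponential moments, so
finite entropy forces a finite mean. -/
lemma summable_mul_mass {c : ℝ} (hc : 0 < c) {δ : ProbabilityMeasure ℕ} (h : relEnt c δ ≠ ∞) :
    Summable (fun r : ℕ => r * mass δ r) := by
  refine Summable.of_nonneg_of_le (fun r => by have := mass_nonneg δ r; positivity) (fun r => ?_)
    ((summable_entTerm hc h).add (hasSum_pois_mul_exp c 1).summable)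
  have := mul_le_entTerm_add hc r (mass_nonneg δ r) r
  have := pois_pos hc r
  rw [one_mul]
  linarith

lemma mean_eq_ofReal {δ : ProbabilityMeasure ℕ} (h : Summable (fun r : ℕ => r * mass δ r)) :
    mean δ = ENNReal.ofReal (realMean δ) := by
  rw [mean_eq, realMean, ENNReal.ofReal_tsum_of_nonneg _ h]
  intro r
  have := mass_nonneg δ r
  positivity

lemma realMean_nonneg (δ : ProbabilityMeasure ℕ) : 0 ≤ realMean δ :=
  tsum_nonneg fun r => mul_nonneg (by positivity) (mass_nonneg δ r)

/-- Uniform integrability on sublevel sets of the relative entropy. -/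
lemma eventually_tsum_mul_mass_le {c : ℝ} (hc : 0 < c) (a : ℝ≥0) {ε : ℝ} (hε : 0 < ε) :
    ∀ᶠ K : ℕ in atTop, ∀ δ : ProbabilityMeasure ℕ, relEnt c δ ≤ a →
      ∑' r : ℕ, ((r + K : ℕ) : ℝ) * mass δ (r + K) ≤ ε := by
  -- Young's inequality with slope `l * r` bounds `l` times the tail of the mean by the entropy, at
  -- most `a`, plus a tail of the Poisson exponential moment, at most 1 for large `K`. This `l`
  -- turns `a + 1` into `ε`.
  set l : ℝ := (a + 1) / ε with hl
  have hlpos : 0 < l := by positivity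
  have htail := tendsto_sum_nat_add (fun r : ℕ => pois c r * Real.exp (l * r))
  filter_upwards [htail.eventually (ge_mem_nhds one_pos)] with K hK δ hδ
  have hfin : relEnt c δ ≠ ∞ := ne_top_of_le_ne_top ENNReal.coe_ne_top hδ
  have hs := summable_entTerm hc hfin
  have hent : ∑' r, entTerm c r (mass δ r) ≤ a := by
    rw [relEnt_eq_ofReal hc hfin] at hδ
    have := ENNReal.ofReal_le_iff_le_toReal ENNReal.coe_ne_top |>.1 hδ
    simpa using this
  have hent' : ∑' r, entTerm c (r + K) (mass δ (r + K)) ≤ a := by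
    refine le_trans ?_ hent
    rw [← hs.sum_add_tsum_nat_add K]
    have := Finset.sum_nonneg (s := Finset.range K)
      fun r _ => entTerm_nonneg hc r (mass_nonneg δ r)
    linarith
  have hs1 := (summable_nat_add_iff K).2 hs
  have hs2 := (summable_nat_add_iff K).2 (hasSum_pois_mul_exp c l).summable
  have hs3 := (summable_nat_add_iff K).2 (summable_mul_mass hc hfin)
  have key : l * ∑' r : ℕ, ((r + K : ℕ) : ℝ) * mass δ (r + K) ≤ a + 1 := by
    rw [← tsum_mul_left]
    calc _ ≤ ∑' r : ℕ, (entTerm c (r + K) (mass δ (r + K))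
          + pois c (r + K) * Real.exp (l * (r + K : ℕ))) := by
          refine (hs3.mul_left l).tsum_le_tsum (fun r => ?_) (hs1.add hs2)
          have := mul_le_entTerm_add hc (r + K) (mass_nonneg δ (r + K)) (l * (r + K : ℕ))
          have := pois_pos hc (r + K)
          linarith
      _ = _ := hs1.tsum_add hs2
      _ ≤ a + 1 := add_le_add hent' hK
  have : l * ε = a + 1 := by rw [hl]; field_simp
  exact le_of_mul_le_mul_left (key.trans_eq this.symm) hlpos

/-- Prokhorov: lower semicontinuity gives closedness, and the tail bound for first moments gives
tightness, since from `K ≥ 1` on masses are dominated by first moments. -/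
lemma isCompact_relEnt_le {c : ℝ} (hc : 0 < c) (a : ℝ≥0) :
    IsCompact {δ : ProbabilityMeasure ℕ | relEnt c δ ≤ a} := by
  have hcl : IsClosed {δ : ProbabilityMeasure ℕ | relEnt c δ ≤ a} :=
    (lowerSemicontinuous_relEnt c).isClosed_preimage (a : ℝ≥0∞)
  rw [← hcl.closure_eq]
  refine isCompact_closure_of_isTightMeasureSet ?_
  refine isTightMeasureSet_iff_exists_isCompact_measure_compl_le.2 fun ε hε => ?_
  obtain ⟨e, he, he'⟩ : ∃ e : ℝ, 0 < e ∧ ENNReal.ofReal e ≤ ε := by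
    rcases eq_or_ne ε ∞ with rfl | h
    · exact ⟨1, one_pos, le_top⟩
    · exact ⟨ε.toReal, ENNReal.toReal_pos hε.ne' h, ENNReal.ofReal_toReal_le⟩
  obtain ⟨K, hK, hK1⟩ := ((eventually_tsum_mul_mass_le hc a he).and (eventually_ge_atTop 1)).exists
  refine ⟨(Finset.range K : Set ℕ), (Finset.range K).finite_toSet.isCompact, ?_⟩
  rintro _ ⟨δ, hδ, rfl⟩
  have hfin : relEnt c δ ≠ ∞ := ne_top_of_le_ne_top ENNReal.coe_ne_top hδ
  refine le_trans ?_ he'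
  rw [← ENNReal.ofReal_toReal (measure_ne_top (δ : Measure ℕ) _), ← measureReal_def]
  refine ENNReal.ofReal_le_ofReal (le_trans ?_ (hK δ hδ))
  have h1 : (δ : Measure ℕ).real (Finset.range K : Set ℕ) = ∑ r ∈ Finset.range K, mass δ r := by
    rw [← sum_measureReal_singleton]; rfl
  rw [measureReal_compl (MeasurableSet.of_discrete), h1, probReal_univ]
  have h2 := (hasSum_mass δ).summable.sum_add_tsum_nat_add K
  rw [(hasSum_mass δ).tsum_eq] at h2
  rw [← h2, add_sub_cancel_left]
  refine ((summable_nat_add_iff K).2 (hasSum_mass δ).summable).tsum_le_tsum (fun r => ?_)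
    ((summable_nat_add_iff K).2 (summable_mul_mass hc hfin))
  have : (1 : ℝ) ≤ ((r + K : ℕ) : ℝ) := by exact_mod_cast le_trans hK1 (Nat.le_add_left _ _)
  nlinarith [mass_nonneg δ (r + K)]

/-- The mean is not weakly continuous in general, but on an entropy sublevel set it is the uniform
limit of the truncated means. -/
lemma continuousOn_realMean {c : ℝ} (hc : 0 < c) (a : ℝ≥0) :
    ContinuousOn realMean {δ : ProbabilityMeasure ℕ | relEnt c δ ≤ a} := by
  have h : TendstoUniformlyOn (fun (K : ℕ) δ => ∑ r ∈ Finset.range K, (r : ℝ) * mass δ r) realMean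
      atTop {δ : ProbabilityMeasure ℕ | relEnt c δ ≤ a} := by
    refine Metric.tendstoUniformlyOn_iff.2 fun ε hε => ?_
    filter_upwards [eventually_tsum_mul_mass_le hc a (half_pos hε)] with K hK δ hδ
    have hfin : relEnt c δ ≠ ∞ := ne_top_of_le_ne_top ENNReal.coe_ne_top hδ
    have h2 := (summable_mul_mass hc hfin).sum_add_tsum_nat_add K
    rw [Real.dist_eq, realMean, ← h2, add_sub_cancel_left, abs_of_nonneg]
    · linarith [hK δ hδ]
    · exact tsum_nonneg fun r => mul_nonneg (by positivity) (mass_nonneg δ _)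
  refine h.continuousOn (Frequently.of_forall fun K => ?_)
  exact (continuous_finsetSum _ fun r _ => continuous_const.mul (continuous_mass r)).continuousOn

/-- Replaces the reference law of mean `⟨δ⟩` by the fixed one of mean `c`, leaving the constraint on
the mean as a separate condition. Finite entropy rules out an infinite mean. -/
lemma rate_le_iff {c : ℝ} (hc : 0 < c) (a : ℝ≥0) (δ : ProbabilityMeasure ℕ) :
    rate c δ ≤ a ↔ relEnt c δ ≤ a ∧ realMean δ = c := by
  have hcc : ((c.toNNReal : ℝ≥0) : ℝ) = c := Real.coe_toNNReal c hc.le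
  have key : InformationTheory.klDiv (δ : Measure ℕ) (poissonMeasure c.toNNReal) = relEnt c δ := by
    rw [klDiv_poissonMeasure (Real.toNNReal_pos.2 hc), hcc]; rfl
  have hmean : relEnt c δ ≤ a → mean δ = ENNReal.ofReal (realMean δ) := fun h =>
    mean_eq_ofReal (summable_mul_mass hc (ne_top_of_le_ne_top ENNReal.coe_ne_top h))
  unfold rate
  split_ifs with h
  · have h1 : (mean δ).toNNReal = c.toNNReal := by rw [← h.2]; simp [ENNReal.toReal]
    rw [h1, key]
    refine ⟨fun h3 => ⟨h3, ?_⟩, fun h3 => h3.1⟩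
    rw [← h.2, hmean h3, ENNReal.toReal_ofReal (realMean_nonneg δ)]
  · refine ⟨fun h3 => absurd h3 (by simp), fun h3 => absurd ?_ h⟩
    rw [hmean h3.1, ENNReal.toReal_ofReal (realMean_nonneg δ)]
    exact ⟨ENNReal.ofReal_ne_top, h3.2⟩

lemma rate_eq {c : ℝ} (hc : 0 < c) {δ : ProbabilityMeasure ℕ} (h : rate c δ ≠ ∞) :
    rate c δ = relEnt c δ ∧ realMean δ = c := by
  obtain ⟨b, hb⟩ : ∃ b : ℝ≥0, (b : ℝ≥0∞) = rate c δ := ⟨_, ENNReal.coe_toNNReal h⟩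
  have h1 := (rate_le_iff hc b δ).1 hb.ge
  refine ⟨le_antisymm ?_ (hb ▸ h1.1), h1.2⟩
  obtain ⟨e, he⟩ : ∃ e : ℝ≥0, (e : ℝ≥0∞) = relEnt c δ :=
    ⟨_, ENNReal.coe_toNNReal (ne_top_of_le_ne_top ENNReal.coe_ne_top h1.1)⟩
  rw [← he]
  exact (rate_le_iff hc e δ).2 ⟨he.ge, h1.2⟩

lemma setOf_rate_le {c : ℝ} (hc : 0 < c) (a : ℝ≥0) :
    {δ : ProbabilityMeasure ℕ | rate c δ ≤ a}
      = {δ | relEnt c δ ≤ a} ∩ realMean ⁻¹' {c} := by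
  ext δ
  exact rate_le_iff hc a δ

lemma isClosed_rate_le {c : ℝ} (hc : 0 < c) (a : ℝ≥0) :
    IsClosed {δ : ProbabilityMeasure ℕ | rate c δ ≤ a} := by
  rw [setOf_rate_le hc]
  exact (continuousOn_realMean hc a).preimage_isClosed_of_isClosed
    (isCompact_relEnt_le hc a).isClosed isClosed_singleton

lemma isCompact_rate_le {c : ℝ} (hc : 0 < c) (a : ℝ≥0) :
    IsCompact {δ : ProbabilityMeasure ℕ | rate c δ ≤ a} := by
  refine (isCompact_relEnt_le hc a).of_isClosed_subset (isClosed_rate_le hc a) ?_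
  rw [setOf_rate_le hc]
  exact Set.inter_subset_left

/-- Close to the prescribed mean, the relative entropy is large on a closed set on which the rate
function is large. -/
lemma exists_relEnt_gt {c : ℝ} (hc : 0 < c) {F : Set (ProbabilityMeasure ℕ)} (hF : IsClosed F)
    (a : ℝ≥0) (ha : ∀ δ ∈ F, a < rate c δ) :
    ∃ ε > 0, ∀ δ ∈ F, |realMean δ - c| < ε → a < relEnt c δ := by
  have hK : IsCompact (realMean '' ({δ | relEnt c δ ≤ a} ∩ F)) :=
    ((isCompact_relEnt_le hc a).inter_right hF).image_of_continuousOn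
      ((continuousOn_realMean hc a).mono Set.inter_subset_left)
  -- The means attained on the part of `F` of entropy at most `a` form a compact set that misses
  -- `c`, hence misses a ball around `c`.
  have hcK : c ∈ (realMean '' ({δ | relEnt c δ ≤ a} ∩ F))ᶜ := by
    rintro ⟨δ, ⟨h1, h2⟩, h3⟩
    exact (ha δ h2).not_ge ((rate_le_iff hc a δ).2 ⟨h1, h3⟩)
  obtain ⟨ε, hε, h⟩ := Metric.isOpen_iff.1 hK.isClosed.isOpen_compl c hcK
  refine ⟨ε, hε, fun δ hδ hm => ?_⟩
  by_contra hcon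
  exact h (Metric.mem_ball.2 (by rwa [Real.dist_eq])) ⟨δ, ⟨not_lt.1 hcon, hδ⟩, rfl⟩

/-! ### Graphs as words of ordered pairs -/

open Classical in
/-- The number of preimages of a point. -/
noncomputable def occ {α β : Type*} [Fintype α] (a : α → β) (b : β) : ℕ :=
  (Finset.univ.filter fun p => a p = b).card

/-- The `j`-th edge of a list of ordered pairs. -/
def wordEdge {m n : ℕ} (a : Fin m × Bool → Fin n) (j : Fin m) : Sym2 (Fin n) :=
  s(a (j, false), a (j, true))

/-- No loops and no multiple edges among the edges with index in `J`. -/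
def SimpleOn {m n : ℕ} (a : Fin m × Bool → Fin n) (J : Set (Fin m)) : Prop :=
  (∀ j ∈ J, ¬ (wordEdge a j).IsDiag) ∧ Set.InjOn (wordEdge a) J

lemma wordEdge_eq {m n : ℕ} (a : Fin m × Bool → Fin n) (j : Fin m) (b : Bool) :
    wordEdge a j = s(a (j, b), a (j, !b)) := by
  cases b
  · rfl
  · exact Sym2.eq_swap

/-- The degree of a vertex is the number of its occurrences in the list of edges. -/
lemma ncard_neighborSet {m n : ℕ} {a : Fin m × Bool → Fin n} (ha : SimpleOn a Set.univ)
    {G : SimpleGraph (Fin n)} (hG : G.edgeSet = Set.range (wordEdge a)) (v : Fin n) :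
    (G.neighborSet v).ncard = occ a v := by
  classical
  have hadj : ∀ w, G.Adj v w ↔ ∃ j, wordEdge a j = s(v, w) := fun w => by
    rw [← SimpleGraph.mem_edgeSet, hG]; rfl
  -- The neighbours of `v` are the partners of its occurrences. Simplicity makes occurrence to
  -- partner injective.
  have him : G.neighborSet v
      = (fun p : Fin m × Bool => a (p.1, !p.2)) '' {p | a p = v} := by
    ext w
    rw [SimpleGraph.mem_neighborSet, hadj]
    constructor
    · rintro ⟨j, hj⟩
      rw [wordEdge, Sym2.eq_iff] at hj
      rcases hj with ⟨h1, h2⟩ | ⟨h1, h2⟩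
      · exact ⟨(j, false), h1, h2⟩
      · exact ⟨(j, true), h2, h1⟩
    · rintro ⟨⟨j, b⟩, hp, rfl⟩
      exact ⟨j, by rw [wordEdge_eq a j b, show a (j, b) = v from hp]⟩
  rw [him, Set.InjOn.ncard_image]
  · rw [occ, ← Set.ncard_coe_finset]
    congr 1
    ext p
    simp
  · rintro ⟨j, b⟩ hp ⟨j', b'⟩ hp' h
    have hp : a (j, b) = v := hp
    have hp' : a (j', b') = v := hp'
    have h : a (j, !b) = a (j', !b') := h
    have hj : j = j' := ha.2 trivial trivial (by
      rw [wordEdge_eq a j b, wordEdge_eq a j' b', hp, hp', h])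
    subst hj
    by_cases hb : b = b'
    · rw [hb]
    -- Both ends of edge `j` would be `v`, a loop.
    · refine absurd ?_ (ha.1 j trivial)
      have : b' = !b := by cases b <;> cases b' <;> simp_all
      rw [wordEdge_eq a j b, hp, ← this, hp']
      rfl

open Classical in
-- An edge that is not a loop has exactly two orientations, chosen independently for each index.
lemma card_wordEdge_eq {m n : ℕ} (e : Fin m → Sym2 (Fin n)) (he : ∀ j, ¬ (e j).IsDiag) :
    (Finset.univ.filter fun a : Fin m × Bool → Fin n => wordEdge a = e).card = 2 ^ m := by
  have h1 : (Finset.univ.filter fun a : Fin m × Bool → Fin n => wordEdge a = e).card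
      = (Fintype.piFinset fun j : Fin m =>
          Finset.univ.filter fun p : Fin n × Fin n => s(p.1, p.2) = e j).card := by
    refine Finset.card_bij' (fun a _ j => (a (j, false), a (j, true)))
      (fun f _ p => if p.2 then (f p.1).2 else (f p.1).1) ?_ ?_ ?_ ?_
    · intro a ha
      simp only [Finset.mem_filter, Finset.mem_univ, true_and] at ha
      simp only [Fintype.mem_piFinset, Finset.mem_filter, Finset.mem_univ, true_and]
      intro j
      rw [← ha]; rfl
    · intro f hf
      simp only [Fintype.mem_piFinset, Finset.mem_filter, Finset.mem_univ, true_and] at hf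
      simp only [Finset.mem_filter, Finset.mem_univ, true_and]
      funext j
      rw [← hf j]
      simp [wordEdge]
    · intro a _
      funext ⟨j, b⟩
      cases b <;> simp
    · intro f _
      funext j
      simp
  rw [h1, Fintype.card_piFinset]
  have h2 : ∀ j, (Finset.univ.filter fun p : Fin n × Fin n => s(p.1, p.2) = e j).card = 2 := by
    intro j
    have := he j
    revert this
    induction e j using Sym2.ind with
    | _ x y =>
      intro hxy
      have hxy : x ≠ y := hxy
      have : (Finset.univ.filter fun p : Fin n × Fin n => s(p.1, p.2) = s(x, y))
          = {(x, y), (y, x)} := by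
        ext ⟨u, v⟩
        simp
      rw [this, Finset.card_pair]
      simp [hxy]
  simp [h2]

/-- The graphs on `n` nodes with `m` edges. -/
noncomputable def graphs (n m : ℕ) : Finset (SimpleGraph (Fin n)) := by
  classical exact Finset.univ.filter fun G => G.edgeSet.ncard = m

lemma mem_graphs {n m : ℕ} {G : SimpleGraph (Fin n)} : G ∈ graphs n m ↔ G.edgeSet.ncard = m := by
  simp [graphs]

lemma not_isDiag_of_mem {V : Type*} {G : SimpleGraph V} {e : Sym2 V} (h : e ∈ G.edgeSet) :
    ¬ e.IsDiag := G.not_isDiag_of_mem_edgeSet h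

open Classical in
-- `m!` orderings of the edges times `2^m` orientations.
lemma card_word_edgeSet {m n : ℕ} {G : SimpleGraph (Fin n)} (hG : G ∈ graphs n m) :
    (Finset.univ.filter fun a : Fin m × Bool → Fin n =>
      SimpleOn a Set.univ ∧ Set.range (wordEdge a) = G.edgeSet).card = m.factorial * 2 ^ m := by
  rw [mem_graphs] at hG
  set T : Finset (Fin m → Sym2 (Fin n)) := Finset.univ.filter fun e =>
    Function.Injective e ∧ ∀ j, e j ∈ G.edgeSet
  have hT : T.card = m.factorial := by
    rw [← Fintype.card_subtype]
    have e1 : {e : Fin m → Sym2 (Fin n) // Function.Injective e ∧ ∀ j, e j ∈ G.edgeSet}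
        ≃ (Fin m ↪ G.edgeSet) :=
      { toFun := fun e => ⟨fun j => ⟨e.1 j, e.2.2 j⟩, fun i j h => e.2.1 (Subtype.ext_iff.1 h)⟩
        invFun := fun f => ⟨fun j => f j, fun i j h => f.injective (Subtype.ext h), fun j => (f j).2⟩
        left_inv := fun _ => rfl
        right_inv := fun _ => rfl }
    rw [Fintype.card_congr e1, Fintype.card_embedding_eq, Fintype.card_fin,
      ← Nat.card_eq_fintype_card, Nat.card_coe_set_eq, hG, Nat.descFactorial_self]
  have hmaps : ∀ a ∈ (Finset.univ.filter fun a : Fin m × Bool → Fin n =>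
      SimpleOn a Set.univ ∧ Set.range (wordEdge a) = G.edgeSet), wordEdge a ∈ T := by
    intro a ha
    simp only [Finset.mem_filter, Finset.mem_univ, true_and] at ha
    simp only [T, Finset.mem_filter, Finset.mem_univ, true_and]
    exact ⟨Set.injOn_univ.1 ha.1.2, fun j => ha.2 ▸ Set.mem_range_self j⟩
  rw [Finset.card_eq_sum_card_fiberwise hmaps, ← hT, ← smul_eq_mul, ← Finset.sum_const]
  refine Finset.sum_congr rfl fun e he => ?_
  simp only [T, Finset.mem_filter, Finset.mem_univ, true_and] at he
  rw [← card_wordEdge_eq e fun j => not_isDiag_of_mem (he.2 j)]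
  congr 1
  ext a
  simp only [Finset.mem_filter, Finset.mem_univ, true_and, and_iff_right_iff_imp]
  rintro rfl
  refine ⟨⟨fun j _ => not_isDiag_of_mem (he.2 j), he.1.injOn⟩, ?_⟩
  refine Set.eq_of_subset_of_ncard_le (Set.range_subset_iff.2 he.2) ?_ (Set.toFinite _)
  rw [hG, ← Set.image_univ, Set.ncard_image_of_injective _ he.1, Set.ncard_univ]
  simp

open Classical in
/-- Counting graphs by counting lists of ordered pairs. -/
lemma card_graphs_mul {m n : ℕ} (Q : (Fin n → ℕ) → Prop) :
    ((graphs n m).filter fun G => Q fun v => (G.neighborSet v).ncard).card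
        * (m.factorial * 2 ^ m)
      = (Finset.univ.filter fun a : Fin m × Bool → Fin n =>
          SimpleOn a Set.univ ∧ Q (occ a)).card := by
  set S := (graphs n m).filter fun G => Q fun v => (G.neighborSet v).ncard
  have hedge : ∀ a : Fin m × Bool → Fin n, SimpleOn a Set.univ →
      (SimpleGraph.fromEdgeSet (Set.range (wordEdge a))).edgeSet = Set.range (wordEdge a) := by
    intro a ha
    rw [SimpleGraph.edgeSet_fromEdgeSet, sdiff_eq_left, Set.disjoint_left]
    rintro _ ⟨j, rfl⟩ h
    exact ha.1 j trivial h
  have hmaps : ∀ a ∈ (Finset.univ.filter fun a : Fin m × Bool → Fin n =>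
      SimpleOn a Set.univ ∧ Q (occ a)), SimpleGraph.fromEdgeSet (Set.range (wordEdge a)) ∈ S := by
    intro a ha
    simp only [Finset.mem_filter, Finset.mem_univ, true_and] at ha
    simp only [S, Finset.mem_filter, mem_graphs]
    constructor
    · rw [hedge a ha.1, ← Set.image_univ,
        Set.ncard_image_of_injective _ (Set.injOn_univ.1 ha.1.2), Set.ncard_univ]
      simp
    · have : (fun v => ((SimpleGraph.fromEdgeSet (Set.range (wordEdge a))).neighborSet v).ncard)
          = occ a := funext fun v => ncard_neighborSet ha.1 (hedge a ha.1) v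
      rw [this]
      exact ha.2
  rw [Finset.card_eq_sum_card_fiberwise hmaps, ← smul_eq_mul, ← Finset.sum_const]
  refine Finset.sum_congr rfl fun G hG => ?_
  simp only [S, Finset.mem_filter] at hG
  rw [← card_word_edgeSet hG.1]
  congr 1
  ext a
  simp only [Finset.mem_filter, Finset.mem_univ, true_and]
  constructor
  · rintro ⟨h1, h2⟩
    refine ⟨⟨h1, ?_⟩, ?_⟩
    · have : occ a = fun v => (G.neighborSet v).ncard :=
        funext fun v => (ncard_neighborSet h1 h2.symm v).symm
      rw [this]
      exact hG.2
    · rw [h2, SimpleGraph.fromEdgeSet_edgeSet]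
  · rintro ⟨⟨h1, h2⟩, rfl⟩
    exact ⟨h1, (hedge a h1).symm⟩

lemma card_graphs (n m : ℕ) : (graphs n m).card = (n.choose 2).choose m := by
  classical
  have h1 : (graphs n m).card
      = (Finset.powersetCard m (Finset.univ.filter fun e : Sym2 (Fin n) => ¬ e.IsDiag)).card := by
    refine Finset.card_bij' (fun G _ => Finset.univ.filter fun e => e ∈ G.edgeSet)
      (fun s _ => SimpleGraph.fromEdgeSet (s : Set (Sym2 (Fin n)))) ?_ ?_ ?_ ?_
    · intro G hG
      rw [mem_graphs] at hG
      rw [Finset.mem_powersetCard]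
      refine ⟨fun e he => ?_, ?_⟩
      · simp only [Finset.mem_filter, Finset.mem_univ, true_and] at he ⊢
        exact not_isDiag_of_mem he
      · rw [← hG, ← Set.ncard_coe_finset]
        simp
    · intro s hs
      rw [Finset.mem_powersetCard] at hs
      rw [mem_graphs, SimpleGraph.edgeSet_fromEdgeSet, sdiff_eq_left.2, Set.ncard_coe_finset, hs.2]
      rw [Set.disjoint_left]
      intro e he h
      exact (Finset.mem_filter.1 (hs.1 he)).2 h
    · intro G _
      simp
    · intro s hs
      rw [Finset.mem_powersetCard] at hs
      ext e
      simp only [SimpleGraph.edgeSet_fromEdgeSet, Finset.mem_filter, Finset.mem_univ, true_and]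
      refine ⟨fun h => h.1, fun h => ⟨h, fun h' => (Finset.mem_filter.1 (hs.1 h)).2 h'⟩⟩
  rw [h1, Finset.card_powersetCard, ← Fintype.card_subtype, Sym2.card_subtype_not_diag,
    Fintype.card_fin]

/-! ### Empirical distributions, and the law in terms of words -/

lemma sum_occ {α β : Type*} [Fintype α] [Fintype β] (a : α → β) :
    ∑ b, occ a b = Fintype.card α := by
  classical
  unfold occ
  rw [← Finset.card_univ, Finset.card_eq_sum_card_fiberwise (f := a) (t := Finset.univ)
    (fun _ _ => Finset.mem_coe.2 (Finset.mem_univ _))]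

lemma occ_le {α β : Type*} [Fintype α] (a : α → β) (b : β) : occ a b ≤ Fintype.card α := by
  unfold occ
  exact Finset.card_le_univ _

lemma sum_comp_eq_sum_occ {α : Type*} [Fintype α] (d : α → ℕ) {M : ℕ} (hd : ∀ v, d v < M)
    (g : ℕ → ℝ) : ∑ v, g (d v) = ∑ r ∈ Finset.range M, occ d r * g r := by
  classical
  rw [← Finset.sum_fiberwise_of_maps_to (s := Finset.univ) (t := Finset.range M) (g := d)
    (fun v _ => Finset.mem_range.2 (hd v))]
  refine Finset.sum_congr rfl fun r _ => ?_
  rw [Finset.sum_congr rfl (g := fun _ => g r)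
    (fun v hv => by rw [(Finset.mem_filter.1 hv).2]), Finset.sum_const, nsmul_eq_mul]
  congr 2
  unfold occ
  congr

lemma isProbabilityMeasure_empirical {n : ℕ} (hn : n ≠ 0) (d : Fin n → ℕ) :
    IsProbabilityMeasure ((n : ℝ≥0∞)⁻¹ • ∑ v : Fin n, Measure.dirac (d v)) := by
  constructor
  simp only [Measure.smul_apply, Measure.finsetSum_apply, measure_univ,
    Finset.sum_const, Finset.card_univ, Fintype.card_fin, smul_eq_mul, nsmul_eq_mul, mul_one]
  exact ENNReal.inv_mul_cancel (by exact_mod_cast hn) (ENNReal.natCast_ne_top n)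

/-- The empirical distribution of a finite sequence. -/
noncomputable def empirical {n : ℕ} (hn : n ≠ 0) (d : Fin n → ℕ) : ProbabilityMeasure ℕ :=
  ⟨(n : ℝ≥0∞)⁻¹ • ∑ v : Fin n, Measure.dirac (d v), isProbabilityMeasure_empirical hn d⟩

lemma mass_empirical {n : ℕ} (hn : n ≠ 0) (d : Fin n → ℕ) (r : ℕ) :
    mass (empirical hn d) r = occ d r / n := by
  classical
  have : (empirical hn d : Measure ℕ) {r} = (n : ℝ≥0∞)⁻¹ * (occ d r : ℝ≥0∞) := by
    change ((n : ℝ≥0∞)⁻¹ • ∑ v : Fin n, Measure.dirac (d v)) {r} = _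
    rw [Measure.smul_apply, Measure.finsetSum_apply, smul_eq_mul]
    congr 1
    simp only [measurableSet_singleton, Measure.dirac_apply', Set.indicator_apply,
      Set.mem_singleton_iff, Pi.one_apply]
    rw [Finset.sum_boole]
    unfold occ
    congr
  rw [mass, measureReal_def, this, ENNReal.toReal_mul, ENNReal.toReal_inv, ENNReal.toReal_natCast,
    ENNReal.toReal_natCast]
  field_simp

lemma degreeDistribution_eq {d n : ℕ} (hn : n ≠ 0) (X : Sample d n) :
    degreeDistribution X = empirical hn fun v => (X.2.neighborSet v).ncard := by
  exact dif_pos hn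

/-- Lets `uniformOn` be evaluated by counting graphs. -/
instance {n : ℕ} : MeasurableSingletonClass (SimpleGraph (Fin n)) := by
  refine ⟨fun G => ?_⟩
  have : ({G} : Set (SimpleGraph (Fin n)))
      = ⋂ u, ⋂ v, {G' | G'.Adj u v ↔ G.Adj u v} := by
    ext G'
    simp only [Set.mem_singleton_iff, Set.mem_iInter, Set.mem_ofPred_eq]
    exact ⟨fun h => by simp [h], fun h => SimpleGraph.ext (by ext u v; exact h u v)⟩
  rw [this]
  refine MeasurableSet.iInter fun u => MeasurableSet.iInter fun v => ?_
  exact measurableSet_setOfPred.2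
    ((SimpleGraph.measurable_iff_adj.1 measurable_id u v).iff measurable_const)

open Classical in
lemma law_preimage {d n m : ℕ} (hn : n ≠ 0) (A : Set (ProbabilityMeasure ℕ)) :
    law d n m (degreeDistribution ⁻¹' A)
      = (((graphs n m).filter fun G => empirical hn (fun v => (G.neighborSet v).ncard) ∈ A).card
          : ℝ≥0∞) / ((graphs n m).card : ℝ≥0∞) := by
  have h1 : (degreeDistribution (d := d) (n := n)) ⁻¹' A
      = Set.univ ×ˢ {G | empirical hn (fun v => (G.neighborSet v).ncard) ∈ A} := by
    ext X
    rw [Set.mem_preimage, degreeDistribution_eq hn]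
    simp
  have h2 : {G : SimpleGraph (Fin n) | G.edgeSet.ncard = m} = (graphs n m : Set _) := by
    ext G
    simp [mem_graphs]
  rw [h1, law, Measure.prod_prod, measure_univ, one_mul, h2]
  have h3 : {G : SimpleGraph (Fin n) | empirical hn (fun v => (G.neighborSet v).ncard) ∈ A}
      = ((Finset.univ.filter fun G : SimpleGraph (Fin n) =>
          empirical hn (fun v => (G.neighborSet v).ncard) ∈ A : Finset _) : Set _) := by
    ext G
    simp
  rw [h3, uniformOn_apply_finset]
  congr 3
  ext G
  simp

open Classical in
lemma law_preimage_eq_word {d n m : ℕ} (hn : n ≠ 0) (hm : m ≤ n.choose 2)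
    (A : Set (ProbabilityMeasure ℕ)) :
    law d n m (degreeDistribution ⁻¹' A)
      = ENNReal.ofReal (((Finset.univ.filter fun a : Fin m × Bool → Fin n =>
          SimpleOn a Set.univ ∧ empirical hn (occ a) ∈ A).card : ℝ)
          / (2 ^ m * (n.choose 2).descFactorial m : ℝ)) := by
  have hpos : 0 < (n.choose 2).choose m := Nat.choose_pos hm
  rw [law_preimage hn, ← card_graphs_mul (fun d => empirical hn d ∈ A), card_graphs,
    Nat.descFactorial_eq_factorial_mul_choose, ENNReal.ofReal_div_of_pos (by positivity)]
  have e : ∀ k : ℕ, ENNReal.ofReal (k : ℝ) = k := ENNReal.ofReal_natCast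
  set S := ((graphs n m).filter fun G =>
    empirical hn (fun v => (G.neighborSet v).ncard) ∈ A).card
  have e1 : (2 ^ m * ((m.factorial * (n.choose 2).choose m : ℕ) : ℝ))
      = (((n.choose 2).choose m * (m.factorial * 2 ^ m) : ℕ) : ℝ) := by push_cast; ring
  rw [e1, e, e]
  push_cast
  rw [ENNReal.mul_div_mul_right]
  · have := m.factorial_ne_zero
    positivity
  · exact ENNReal.mul_ne_top (ENNReal.natCast_ne_top _) (ENNReal.pow_ne_top (by simp))

open Classical in
-- Simplicity is dropped, and every factor of the falling factorial is at least `n.choose 2 + 1 -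
-- m`.
lemma law_preimage_le {d n m : ℕ} (hn : n ≠ 0) (hm : m ≤ n.choose 2)
    (A : Set (ProbabilityMeasure ℕ)) :
    law d n m (degreeDistribution ⁻¹' A)
      ≤ ENNReal.ofReal (((Finset.univ.filter fun a : Fin m × Bool → Fin n =>
          empirical hn (occ a) ∈ A).card : ℝ) / (2 * ((n.choose 2 : ℝ) + 1 - m)) ^ m) := by
  rw [law_preimage_eq_word hn hm]
  have hm' : (m : ℝ) ≤ n.choose 2 := by exact_mod_cast hm
  refine ENNReal.ofReal_le_ofReal (div_le_div₀ (by positivity) ?_ ?_ ?_)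
  · exact_mod_cast Finset.card_le_card fun a ha => by
      simp only [Finset.mem_filter, Finset.mem_univ, true_and] at ha ⊢
      exact ha.2
  · have : 0 < 2 * ((n.choose 2 : ℝ) + 1 - m) := by linarith
    positivity
  · rw [mul_pow]
    refine mul_le_mul_of_nonneg_left ?_ (by positivity)
    have := Nat.pow_sub_le_descFactorial (n.choose 2) m
    have h2 : (((n.choose 2 + 1 - m) ^ m : ℕ) : ℝ) ≤ ((n.choose 2).descFactorial m : ℝ) := by
      exact_mod_cast this
    rwa [Nat.cast_pow, Nat.cast_sub (by omega), Nat.cast_add, Nat.cast_one] at h2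

open Classical in
-- There are at most `n^(2m)` words in all, a bound for the normalisation since `2 * n.choose 2 ≤
-- n^2`.
lemma le_law_preimage {d n m : ℕ} (hn : n ≠ 0) (hm : m ≤ n.choose 2)
    (A : Set (ProbabilityMeasure ℕ)) :
    ENNReal.ofReal (((Finset.univ.filter fun a : Fin m × Bool → Fin n =>
          SimpleOn a Set.univ ∧ empirical hn (occ a) ∈ A).card : ℝ) / (n : ℝ) ^ (2 * m))
      ≤ law d n m (degreeDistribution ⁻¹' A) := by
  rw [law_preimage_eq_word hn hm]
  refine ENNReal.ofReal_le_ofReal (div_le_div_of_nonneg_left (by positivity) ?_ ?_)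
  · have := Nat.descFactorial_pos.2 hm
    positivity
  · have h1 : (n.choose 2).descFactorial m ≤ (n.choose 2) ^ m := Nat.descFactorial_le_pow _ _
    have h2 : 2 * n.choose 2 ≤ n ^ 2 := by
      rw [Nat.choose_two_right]
      have := Nat.div_mul_le_self (n * (n - 1)) 2
      have : n * (n - 1) ≤ n ^ 2 := by rw [sq]; exact Nat.mul_le_mul_left _ (Nat.sub_le _ _)
      omega
    have h3 : 2 ^ m * (n.choose 2).descFactorial m ≤ n ^ (2 * m) := by
      calc 2 ^ m * (n.choose 2).descFactorial m ≤ 2 ^ m * (n.choose 2) ^ m := by gcongr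
        _ = (2 * n.choose 2) ^ m := (mul_pow _ _ _).symm
        _ ≤ (n ^ 2) ^ m := by gcongr
        _ = n ^ (2 * m) := (pow_mul _ _ _).symm
    exact_mod_cast h3

/-! ### Multinomial counting and the method of types -/

lemma exists_occ_eq {α β : Type*} [Fintype α] [Fintype β] {k : β → ℕ}
    (hk : ∑ b, k b = Fintype.card α) : ∃ f : α → β, occ f = k := by
  classical
  have e : α ≃ Σ b, Fin (k b) := Fintype.equivOfCardEq (by simp [hk])
  refine ⟨fun p => (e p).1, funext fun b => ?_⟩
  unfold occ
  rw [← Fintype.card_subtype]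
  have e2 : {p : α // (e p).1 = b} ≃ {q : Σ b, Fin (k b) // q.1 = b} :=
    e.subtypeEquiv fun _ => Iff.rfl
  rw [Fintype.card_congr (e2.trans (Equiv.sigmaSubtype b)), Fintype.card_fin]

open Classical in
/-- The multinomial coefficient counts the functions with fibres of given sizes. -/
lemma card_occ_eq_mul {α β : Type*} [Fintype α] [DecidableEq α] [Fintype β] {k : β → ℕ}
    (hk : ∑ b, k b = Fintype.card α) :
    (Finset.univ.filter fun f : α → β => occ f = k).card * ∏ b, (k b).factorial
      = (Fintype.card α).factorial := by
  obtain ⟨f₀, hf₀⟩ := exists_occ_eq hk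
  have hfib : ∀ (f : α → β) b, Fintype.card {p // f p = b} = occ f b := fun f b => by
    rw [Fintype.card_subtype]; rfl
  -- Permutations act on the positions. All functions with the given fibre sizes form one orbit, and
  -- each fibre of `σ ↦ f₀ ∘ σ` is a translate of the stabilizer of `f₀`, which has `∏ b, (k b)!`
  -- elements.
  have hmaps : ∀ σ ∈ (Finset.univ : Finset (Equiv.Perm α)),
      f₀ ∘ σ ∈ Finset.univ.filter fun f : α → β => occ f = k := by
    intro σ _
    simp only [Finset.mem_filter, Finset.mem_univ, true_and]
    rw [← hf₀]
    funext b
    rw [← hfib, ← hfib]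
    exact Fintype.card_congr (σ.subtypeEquiv fun _ => Iff.rfl)
  rw [← Fintype.card_perm, ← Finset.card_univ, Finset.card_eq_sum_card_fiberwise hmaps,
    ← smul_eq_mul, ← Finset.sum_const]
  refine Finset.sum_congr rfl fun f hf => ?_
  simp only [Finset.mem_filter, Finset.mem_univ, true_and] at hf
  have hτ : ∃ τ : Equiv.Perm α, f₀ ∘ τ = f := by
    have e : ∀ b, {p // f p = b} ≃ {p // f₀ p = b} := fun b =>
      Fintype.equivOfCardEq (by rw [hfib, hfib, hf, hf₀])
    exact ⟨Equiv.ofFiberEquiv e, funext fun p => Equiv.ofFiberEquiv_map e p⟩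
  obtain ⟨τ, rfl⟩ := hτ
  have h := DomMulAct.stabilizer_card f₀
  simp only [hfib, hf₀] at h
  rw [← h, Fintype.card_subtype]
  refine Finset.card_bij' (fun σ _ => σ * τ) (fun σ _ => σ * τ⁻¹) ?_ ?_ ?_ ?_
  · intro σ hσ
    simp only [Finset.mem_filter, Finset.mem_univ, true_and] at hσ ⊢
    rw [Equiv.Perm.coe_mul, ← Function.comp_assoc, hσ]
  · intro σ hσ
    simp only [Finset.mem_filter, Finset.mem_univ, true_and] at hσ ⊢
    rw [Equiv.Perm.coe_mul, ← Function.comp_assoc, hσ, Function.comp_assoc, ← Equiv.Perm.coe_mul]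
    simp
  · intro σ _; simp
  · intro σ _; simp

lemma occ_pos {α β : Type*} [Fintype α] (a : α → β) (p : α) : 0 < occ a (a p) := by
  classical
  unfold occ
  exact Finset.card_pos.2 ⟨p, by simp⟩

lemma occ_eq_zero_iff {α β : Type*} [Fintype α] {a : α → β} {b : β} :
    occ a b = 0 ↔ ∀ p, a p ≠ b := by
  simp [occ, Finset.filter_eq_empty_iff]

lemma occ_eq_zero_of_le {n M : ℕ} {d : Fin n → ℕ} (hd : ∀ v, d v < M) {r : ℕ} (hr : M ≤ r) :
    occ d r = 0 := by
  refine occ_eq_zero_iff.2 fun v => ?_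
  have := hd v
  omega

lemma mass_empirical_pos {n : ℕ} (hn : n ≠ 0) (d : Fin n → ℕ) (v : Fin n) :
    0 < mass (empirical hn d) (d v) := by
  rw [mass_empirical]
  have := occ_pos d v
  positivity

/-- Entropy of an empirical distribution as an average of log-likelihood ratios along the sequence,
the form needed for a change of measure. -/
lemma relEnt_empirical {c : ℝ} (hc : 0 < c) {n : ℕ} (hn : n ≠ 0) (d : Fin n → ℕ) :
    relEnt c (empirical hn d)
      = ENNReal.ofReal ((∑ v, Real.log (mass (empirical hn d) (d v) / pois c (d v))) / n) := by
  obtain ⟨M, hM⟩ : ∃ M, ∀ v, d v < M :=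
    ⟨(Finset.univ.sup d) + 1, fun v => Nat.lt_succ_of_le (Finset.le_sup (Finset.mem_univ v))⟩
  set δ := empirical hn d
  have hz : ∀ r, M ≤ r → mass δ r = 0 := fun r hr => by
    rw [mass_empirical, occ_eq_zero_of_le hM hr]; simp
  have h1 : HasSum (fun r => mass δ r * Real.log (mass δ r / pois c r))
      (∑ r ∈ Finset.range M, mass δ r * Real.log (mass δ r / pois c r)) := by
    refine hasSum_sum_of_ne_finset_zero fun r hr => ?_
    rw [hz r (by simpa using hr), zero_mul]
  have h2 : HasSum (fun r => entTerm c r (mass δ r))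
      (∑ r ∈ Finset.range M, mass δ r * Real.log (mass δ r / pois c r)) := by
    have := (h1.sub (hasSum_mass δ)).add (hasSum_pois c)
    rw [sub_add_cancel] at this
    exact this.congr_fun fun r => entTerm_eq hc r _
  rw [relEnt, ← ENNReal.ofReal_tsum_of_nonneg (fun r => entTerm_nonneg hc r (mass_nonneg δ r))
    h2.summable, h2.tsum_eq, sum_comp_eq_sum_occ d hM fun r => Real.log (mass δ r / pois c r),
    Finset.sum_div]
  congr 1
  refine Finset.sum_congr rfl fun r _ => ?_
  rw [mass_empirical]
  ring

lemma realMean_empirical {n : ℕ} (hn : n ≠ 0) (d : Fin n → ℕ) :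
    realMean (empirical hn d) = ((∑ v, d v : ℕ) : ℝ) / n := by
  obtain ⟨M, hM⟩ : ∃ M, ∀ v, d v < M :=
    ⟨(Finset.univ.sup d) + 1, fun v => Nat.lt_succ_of_le (Finset.le_sup (Finset.mem_univ v))⟩
  rw [realMean, tsum_eq_sum (s := Finset.range M), Nat.cast_sum,
    sum_comp_eq_sum_occ d hM fun r => (r : ℝ), Finset.sum_div]
  · refine Finset.sum_congr rfl fun r _ => ?_
    rw [mass_empirical]
    ring
  · intro r hr
    rw [mass_empirical, occ_eq_zero_of_le hM (by simpa using hr)]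
    simp

open Classical in
/-- The probability of a type class. -/
lemma sum_prod_pois_le {c : ℝ} (hc : 0 < c) {n : ℕ} (hn : n ≠ 0) (M : ℕ)
    (δ : ProbabilityMeasure ℕ) {h : ℝ} (hh : ENNReal.ofReal h ≤ relEnt c δ) (hh0 : 0 < h) :
    ∑ d ∈ (Fintype.piFinset fun _ : Fin n => Finset.range M).filter
        (fun d => empirical hn d = δ), ∏ v, pois c (d v) ≤ Real.exp (-(n * h)) := by
  -- On the type class of `δ`, the product Poisson weight is `exp (-n * H)` times the weight under
  -- the product of `δ`, and the latter weights sum to at most 1.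
  have h1 : ∀ d : Fin n → ℕ, empirical hn d = δ →
      ∏ v, pois c (d v) ≤ Real.exp (-(n * h)) * ∏ v, mass δ (d v) := by
    rintro d rfl
    have hm := mass_empirical_pos hn d
    rw [relEnt_empirical hc, ENNReal.ofReal_le_ofReal_iff'] at hh
    have hh := hh.resolve_right (by linarith)
    rw [le_div_iff₀ (by positivity)] at hh
    have h2 : ∀ v, pois c (d v) = Real.exp (-Real.log (mass (empirical hn d) (d v) / pois c (d v)))
        * mass (empirical hn d) (d v) := by
      intro v
      have := pois_pos hc (d v)
      have := hm v
      rw [Real.exp_neg, Real.exp_log (by positivity)]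
      field_simp
    rw [Finset.prod_congr rfl fun v _ => h2 v, Finset.prod_mul_distrib, ← Real.exp_sum]
    refine mul_le_mul_of_nonneg_right (Real.exp_le_exp.2 ?_)
      (Finset.prod_nonneg fun v _ => mass_nonneg _ _)
    rw [Finset.sum_neg_distrib]
    linarith
  calc _ ≤ ∑ d ∈ (Fintype.piFinset fun _ : Fin n => Finset.range M).filter
        (fun d => empirical hn d = δ), Real.exp (-(n * h)) * ∏ v, mass δ (d v) :=
        Finset.sum_le_sum fun d hd => h1 d (Finset.mem_filter.1 hd).2
    _ ≤ ∑ d ∈ (Fintype.piFinset fun _ : Fin n => Finset.range M),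
          Real.exp (-(n * h)) * ∏ v, mass δ (d v) :=
        Finset.sum_le_sum_of_subset_of_nonneg (Finset.filter_subset _ _) fun d _ _ =>
          mul_nonneg (Real.exp_nonneg _) (Finset.prod_nonneg fun v _ => mass_nonneg _ _)
    _ = Real.exp (-(n * h)) * (∑ r ∈ Finset.range M, mass δ r) ^ n := by
        rw [← Finset.mul_sum, ← Finset.prod_univ_sum]
        simp
    _ ≤ Real.exp (-(n * h)) * 1 := by
        refine mul_le_mul_of_nonneg_left (pow_le_one₀ ?_ ?_) (Real.exp_nonneg _)
        · exact Finset.sum_nonneg fun r _ => mass_nonneg δ r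
        · exact sum_le_hasSum _ (fun r _ => mass_nonneg δ r) (hasSum_mass δ)
    _ = _ := mul_one _

/-- The sequences of `n` natural numbers with sum `M`. -/
noncomputable def seqs (n M : ℕ) : Finset (Fin n → ℕ) := by
  classical
  exact Finset.filter (fun d => ∑ v, d v = M)
    (Fintype.piFinset fun _ : Fin n => Finset.range (M + 1))

lemma mem_seqs {n M : ℕ} {d : Fin n → ℕ} : d ∈ seqs n M ↔ ∑ v, d v = M := by
  simp only [seqs, Finset.mem_filter, Fintype.mem_piFinset, Finset.mem_range,
    and_iff_right_iff_imp]
  rintro rfl v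
  exact Nat.lt_succ_of_le (Finset.single_le_sum (fun _ _ => Nat.zero_le _) (Finset.mem_univ v))

lemma lt_of_mem_seqs {n M : ℕ} {d : Fin n → ℕ} (hd : d ∈ seqs n M) (v : Fin n) : d v < M + 1 := by
  simp only [seqs, Finset.mem_filter, Fintype.mem_piFinset, Finset.mem_range] at hd
  exact hd.1 v

/-- A truncated Euler product for partitions, bounded uniformly in `M`: each factor is `1 + y / (1 -
y) ≤ exp (y / (1 - y))` with `y = x^(r+1)`, and the exponents are dominated by a geometric series.
-/
lemma prod_one_div_one_sub_pow_le {x : ℝ} (hx0 : 0 < x) (hx1 : x < 1) (M : ℕ) :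
    ∏ r ∈ Finset.range M, (1 - x ^ (r + 1))⁻¹ ≤ Real.exp (1 / (1 - x) ^ 2) := by
  have h1x : 0 < 1 - x := by linarith
  have h1 : ∀ r : ℕ, (1 - x ^ (r + 1))⁻¹ ≤ Real.exp (x ^ r / (1 - x)) := by
    intro r
    have hp : x ^ (r + 1) ≤ x := by
      rw [pow_succ]
      exact mul_le_of_le_one_left hx0.le (pow_le_one₀ hx0.le hx1.le)
    have hp' : x ^ (r + 1) ≤ x ^ r := pow_le_pow_of_le_one hx0.le hx1.le (Nat.le_succ r)
    have hpos : 0 < 1 - x ^ (r + 1) := by linarith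
    have h2 : (1 - x ^ (r + 1))⁻¹ = x ^ (r + 1) / (1 - x ^ (r + 1)) + 1 := by
      field_simp; ring
    rw [h2]
    refine (Real.add_one_le_exp _).trans (Real.exp_le_exp.2 ?_)
    exact div_le_div₀ (by positivity) hp' h1x (by linarith)
  calc _ ≤ ∏ r ∈ Finset.range M, Real.exp (x ^ r / (1 - x)) := by
        refine Finset.prod_le_prod (fun r _ => ?_) fun r _ => h1 r
        have : x ^ (r + 1) ≤ 1 := pow_le_one₀ hx0.le hx1.le
        exact inv_nonneg.2 (by linarith)
    _ = Real.exp ((∑ r ∈ Finset.range M, x ^ r) / (1 - x)) := by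
        rw [← Real.exp_sum, Finset.sum_div]
    _ ≤ Real.exp (1 / (1 - x) ^ 2) := by
        refine Real.exp_le_exp.2 ?_
        have h3 : ∑ r ∈ Finset.range M, x ^ r ≤ (1 - x)⁻¹ :=
          sum_le_hasSum _ (fun r _ => by positivity) (hasSum_geometric_of_lt_one hx0.le hx1)
        calc _ ≤ (1 - x)⁻¹ / (1 - x) := by gcongr
          _ = _ := by field_simp

open Classical in
/-- There are subexponentially many types. -/
lemma card_image_empirical_mul_le {n : ℕ} (hn : n ≠ 0) (M : ℕ) {x : ℝ} (hx0 : 0 < x)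
    (hx1 : x < 1) :
    (((seqs n M).image (empirical hn)).card : ℝ) * x ^ M
      ≤ (n + 1) * Real.exp (1 / (1 - x) ^ 2) := by
  -- A type is determined by how often each value `r ≤ M` occurs.
  set κ : (Fin n → ℕ) → (Fin (M + 1) → ℕ) := fun d r => occ d r
  have hκ : ∀ d ∈ seqs n M, ∀ d' ∈ seqs n M, κ d = κ d' → empirical hn d = empirical hn d' := by
    intro d hd d' hd' h
    refine ext_mass fun r => ?_
    rw [mass_empirical, mass_empirical]
    by_cases hr : r < M + 1
    · have : occ d r = occ d' r := congrFun h ⟨r, hr⟩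
      rw [this]
    · rw [occ_eq_zero_of_le (lt_of_mem_seqs hd) (not_lt.1 hr),
        occ_eq_zero_of_le (lt_of_mem_seqs hd') (not_lt.1 hr)]
  have h1 : ((seqs n M).image (empirical hn)).card ≤ ((seqs n M).image κ).card := by
    have hex : ∀ δ ∈ (seqs n M).image (empirical hn), ∃ d ∈ seqs n M, empirical hn d = δ :=
      fun δ hδ => Finset.mem_image.1 hδ
    choose! g hg hg' using hex
    refine Finset.card_le_card_of_injOn (fun δ => κ (g δ))
      (fun δ hδ => Finset.mem_coe.2 (Finset.mem_image_of_mem _ (hg δ hδ))) ?_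
    intro δ hδ δ' hδ' h
    rw [← hg' δ hδ, ← hg' δ' hδ']
    exact hκ _ (hg δ hδ) _ (hg δ' hδ') h
  -- Count vectors satisfy `∑ r, r * k r = M`, so `x^M` splits as a product over `r`. Summing over
  -- all vectors with entries at most `n` then factorises into truncated geometric series, the value
  -- `r = 0` contributing `n + 1`.
  have h2 : ∀ k ∈ (seqs n M).image κ, x ^ M = ∏ r : Fin (M + 1), (x ^ (r : ℕ)) ^ k r := by
    intro k hk
    obtain ⟨d, hd, rfl⟩ := Finset.mem_image.1 hk
    simp_rw [← pow_mul, Finset.prod_pow_eq_pow_sum]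
    congr 1
    have h := sum_comp_eq_sum_occ d (lt_of_mem_seqs hd) fun r => (r : ℝ)
    rw [← Nat.cast_sum, mem_seqs.1 hd] at h
    rw [Fin.sum_univ_eq_sum_range fun r => r * occ d r]
    have : ((M : ℕ) : ℝ) = ((∑ r ∈ Finset.range (M + 1), r * occ d r : ℕ) : ℝ) := by
      rw [h]
      push_cast
      exact Finset.sum_congr rfl fun r _ => mul_comm _ _
    exact_mod_cast this
  calc (((seqs n M).image (empirical hn)).card : ℝ) * x ^ M
      ≤ (((seqs n M).image κ).card : ℝ) * x ^ M := by gcongr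
    _ = ∑ k ∈ (seqs n M).image κ, ∏ r : Fin (M + 1), (x ^ (r : ℕ)) ^ k r := by
        rw [← Finset.sum_congr rfl h2, Finset.sum_const, nsmul_eq_mul]
    _ ≤ ∑ k ∈ Fintype.piFinset fun _ : Fin (M + 1) => Finset.range (n + 1),
          ∏ r : Fin (M + 1), (x ^ (r : ℕ)) ^ k r := by
        refine Finset.sum_le_sum_of_subset_of_nonneg ?_ fun k _ _ => by positivity
        intro k hk
        obtain ⟨d, -, rfl⟩ := Finset.mem_image.1 hk
        simp only [Fintype.mem_piFinset, Finset.mem_range]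
        intro r
        have := occ_le d (r : ℕ)
        rw [Fintype.card_fin] at this
        exact Nat.lt_succ_of_le this
    _ = ∏ r : Fin (M + 1), ∑ j ∈ Finset.range (n + 1), (x ^ (r : ℕ)) ^ j :=
        (Finset.prod_univ_sum _ _).symm
    _ = (n + 1) * ∏ r ∈ Finset.range M, ∑ j ∈ Finset.range (n + 1), (x ^ (r + 1)) ^ j := by
        rw [Fin.prod_univ_eq_prod_range (fun r => ∑ j ∈ Finset.range (n + 1), (x ^ r) ^ j),
          Finset.prod_range_succ', mul_comm]
        simp
    _ ≤ (n + 1) * ∏ r ∈ Finset.range M, (1 - x ^ (r + 1))⁻¹ := by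
        refine mul_le_mul_of_nonneg_left (Finset.prod_le_prod (fun r _ => by positivity)
          fun r _ => ?_) (by positivity)
        exact sum_le_hasSum _ (fun j _ => by positivity)
          (hasSum_geometric_of_lt_one (by positivity) (pow_lt_one₀ hx0.le hx1 (by omega)))
    _ ≤ _ := mul_le_mul_of_nonneg_left (prod_one_div_one_sub_pow_le hx0 hx1 M) (by positivity)

lemma prod_pois {c : ℝ} {n : ℕ} (d : Fin n → ℕ) :
    ∏ v, pois c (d v)
      = Real.exp (-(c * n)) * c ^ (∑ v, d v) / ((∏ v, (d v).factorial : ℕ) : ℝ) := by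
  unfold pois
  rw [Finset.prod_div_distrib, Finset.prod_mul_distrib, Finset.prod_const, Finset.card_univ,
    Fintype.card_fin, ← Real.exp_nat_mul, Finset.prod_pow_eq_pow_sum]
  push_cast
  congr 3
  ring

open Classical in
/-- The number of lists of edges whose degree distribution lies in a given set. -/
lemma card_word_le {c : ℝ} (hc : 0 < c) {n : ℕ} (hn : n ≠ 0) (m : ℕ)
    (A : Set (ProbabilityMeasure ℕ)) {h : ℝ} (hh0 : 0 < h)
    (hA : ∀ d ∈ seqs n (2 * m), empirical hn d ∈ A → ENNReal.ofReal h ≤ relEnt c (empirical hn d))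
    {x : ℝ} (hx0 : 0 < x) (hx1 : x < 1) :
    ((Finset.univ.filter fun a : Fin m × Bool → Fin n => empirical hn (occ a) ∈ A).card : ℝ)
      ≤ (n + 1) * Real.exp (1 / (1 - x) ^ 2) / x ^ (2 * m)
        * ((2 * m).factorial * Real.exp (c * n) / c ^ (2 * m)) * Real.exp (-(n * h)) := by
  have hcard : Fintype.card (Fin m × Bool) = 2 * m := by simp [mul_comm]
  set S := (seqs n (2 * m)).filter fun d => empirical hn d ∈ A
  -- The number of words with letter counts `d` is `(2m)! / ∏ v, (d v)!`, which is `K` times the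
  -- product Poisson weight of `d`.
  set K : ℝ := (2 * m).factorial * Real.exp (c * n) / c ^ (2 * m)
  have hK : 0 < K := by positivity
  have hmaps : ∀ a ∈ (Finset.univ.filter fun a : Fin m × Bool → Fin n =>
      empirical hn (occ a) ∈ A), occ a ∈ S := by
    intro a ha
    simp only [Finset.mem_filter, Finset.mem_univ, true_and] at ha
    exact Finset.mem_filter.2 ⟨mem_seqs.2 ((sum_occ a).trans hcard), ha⟩
  have h1 : ∀ d ∈ S, (((Finset.univ.filter fun a : Fin m × Bool → Fin n =>
      empirical hn (occ a) ∈ A).filter fun a => occ a = d).card : ℝ) ≤ K * ∏ v, pois c (d v) := by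
    intro d hd
    have hd1 := mem_seqs.1 (Finset.mem_filter.1 hd).1
    have h2 := card_occ_eq_mul (α := Fin m × Bool) (k := d) (hd1.trans hcard.symm)
    have h3 : ((Finset.univ.filter fun a : Fin m × Bool → Fin n =>
      empirical hn (occ a) ∈ A).filter fun a => occ a = d).card
        ≤ (Finset.univ.filter fun a : Fin m × Bool → Fin n => occ a = d).card :=
      Finset.card_le_card (Finset.filter_subset_filter _ (Finset.filter_subset _ _))
    have hp : 0 < ∏ v, (d v).factorial := Finset.prod_pos fun v _ => Nat.factorial_pos _
    rw [prod_pois, hd1, Real.exp_neg]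
    have h4 : K * ((Real.exp (c * n))⁻¹ * c ^ (2 * m) / ((∏ v, (d v).factorial : ℕ) : ℝ))
        = (2 * m).factorial / ((∏ v, (d v).factorial : ℕ) : ℝ) := by
      simp only [K]
      field_simp
    rw [h4, le_div_iff₀ (by exact_mod_cast hp)]
    rw [hcard] at h2
    rw [← h2]
    exact_mod_cast Nat.mul_le_mul_right _ h3
  have h5 : ∑ d ∈ S, ∏ v, pois c (d v)
      ≤ (((seqs n (2 * m)).image (empirical hn)).card : ℝ) * Real.exp (-(n * h)) := by
    -- The sum is split into type classes, each of weight at most `exp (-n * h)`.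
    rw [← Finset.sum_fiberwise_of_maps_to (t := S.image (empirical hn))
      (fun d hd => Finset.mem_image_of_mem _ hd)]
    calc _ ≤ ∑ _δ ∈ S.image (empirical hn), Real.exp (-(n * h)) := by
          refine Finset.sum_le_sum fun δ hδ => ?_
          obtain ⟨d, hd, rfl⟩ := Finset.mem_image.1 hδ
          have hd := Finset.mem_filter.1 hd
          refine le_trans (Finset.sum_le_sum_of_subset_of_nonneg ?_ fun d _ _ =>
            Finset.prod_nonneg fun v _ => (pois_pos hc _).le)
            (sum_prod_pois_le hc hn (2 * m + 1) _ (hA d hd.1 hd.2) hh0)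
          refine Finset.filter_subset_filter _ fun d' hd' => ?_
          exact Fintype.mem_piFinset.2 fun v => Finset.mem_range.2
            (lt_of_mem_seqs (Finset.mem_filter.1 hd').1 v)
      _ = ((S.image (empirical hn)).card : ℝ) * Real.exp (-(n * h)) := by
          rw [Finset.sum_const, nsmul_eq_mul]
      _ ≤ _ := by
          gcongr
          exact Finset.filter_subset _ _
  have h6 := card_image_empirical_mul_le hn (2 * m) hx0 hx1
  rw [← le_div_iff₀ (by positivity)] at h6
  calc _ = ∑ d ∈ S, (((Finset.univ.filter fun a : Fin m × Bool → Fin n =>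
      empirical hn (occ a) ∈ A).filter fun a => occ a = d).card : ℝ) := by
        rw [Finset.card_eq_sum_card_fiberwise hmaps, Nat.cast_sum]
    _ ≤ ∑ d ∈ S, K * ∏ v, pois c (d v) := Finset.sum_le_sum h1
    _ = K * ∑ d ∈ S, ∏ v, pois c (d v) := (Finset.mul_sum _ _ _).symm
    _ ≤ K * ((((seqs n (2 * m)).image (empirical hn)).card : ℝ) * Real.exp (-(n * h))) := by gcongr
    _ ≤ K * (((n + 1) * Real.exp (1 / (1 - x) ^ 2) / x ^ (2 * m)) * Real.exp (-(n * h))) := by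
        gcongr
    _ = _ := by ring

/-! ### Loops and multiple edges in random words -/

open Classical in
/-- Averaging over all positions, in a family of words that is invariant under permutations of the
positions. -/
lemma card_filter_mul_descFactorial_le {α β : Type*} [Fintype α] {k : ℕ} {W : Finset (α → β)}
    (hW : ∀ a ∈ W, ∀ τ : Equiv.Perm α, a ∘ τ ∈ W) (R : (Fin k → β) → Prop) {C : ℕ}
    (hC : ∀ a ∈ W, (Finset.univ.filter fun e : Fin k ↪ α => R (a ∘ e)).card ≤ C)
    (e₀ : Fin k ↪ α) :
    (W.filter fun a => R (a ∘ e₀)).card * (Fintype.card α).descFactorial k ≤ W.card * C := by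
  have h1 : ∀ e : Fin k ↪ α,
      (W.filter fun a => R (a ∘ e₀)).card = (W.filter fun a => R (a ∘ e)).card := by
    intro e
    -- Permutations are transitive on `k`-tuples of distinct positions, so by invariance of `W` the
    -- count is the same for every tuple. Summing over tuples and exchanging the sums gives the
    -- bound.
    obtain ⟨τ, hτ⟩ : ∃ τ : Equiv.Perm α, τ • e₀ = e :=
      haveI := Equiv.Perm.isMultiplyPretransitive α k
      MulAction.exists_smul_eq (Equiv.Perm α) e₀ e
    have hτ' : ∀ a : α → β, (a ∘ τ) ∘ e₀ = a ∘ e := fun a => by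
      rw [← hτ]; rfl
    have hτ'' : ∀ a : α → β, (a ∘ τ.symm) ∘ e = a ∘ e₀ := fun a => by
      rw [← hτ', Function.comp_assoc a, Equiv.symm_comp_self]; rfl
    refine Finset.card_bij' (fun a _ => a ∘ τ.symm) (fun a _ => a ∘ τ) ?_ ?_ ?_ ?_
    · intro a ha
      rw [Finset.mem_filter] at ha ⊢
      exact ⟨hW a ha.1 _, by rw [hτ'']; exact ha.2⟩
    · intro a ha
      rw [Finset.mem_filter] at ha ⊢
      exact ⟨hW a ha.1 _, by rw [hτ']; exact ha.2⟩
    · intro a _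
      rw [Function.comp_assoc, Equiv.symm_comp_self]; rfl
    · intro a _
      rw [Function.comp_assoc, Equiv.self_comp_symm]; rfl
  calc (W.filter fun a => R (a ∘ e₀)).card * (Fintype.card α).descFactorial k
      = ∑ e : Fin k ↪ α, (W.filter fun a => R (a ∘ e)).card := by
        rw [← Finset.sum_congr rfl fun e _ => h1 e, Finset.sum_const, Finset.card_univ,
          Fintype.card_embedding_eq, Fintype.card_fin, smul_eq_mul, mul_comm]
    _ = ∑ a ∈ W, (Finset.univ.filter fun e : Fin k ↪ α => R (a ∘ e)).card :=
        (Finset.sum_card_bipartiteAbove_eq_sum_card_bipartiteBelow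
          (fun (a : α → β) (e : Fin k ↪ α) => R (a ∘ e))).symm
    _ ≤ W.card * C := by
        rw [← smul_eq_mul]
        exact Finset.sum_le_card_nsmul W _ C hC

open Classical in
-- Once the first position is chosen, its letter has at most `D` occurrences available for the
-- second.
lemma card_pairs_le {α β : Type*} [Fintype α] {a : α → β} {D : ℕ} (h : ∀ b, occ a b ≤ D) :
    (Finset.univ.filter fun p : α × α => a p.1 = a p.2).card ≤ Fintype.card α * D := by
  have : ∀ p ∈ (Finset.univ.filter fun p : α × α => a p.1 = a p.2), p.1 ∈ Finset.univ :=
    fun p _ => Finset.mem_univ _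
  rw [Finset.card_eq_sum_card_fiberwise this, ← Finset.card_univ, ← smul_eq_mul]
  refine Finset.sum_le_card_nsmul _ _ _ fun x _ => le_trans ?_ (h (a x))
  refine Finset.card_le_card_of_injOn Prod.snd ?_ ?_
  · intro p hp
    simp only [Finset.coe_filter, Finset.mem_filter, Finset.mem_univ, true_and] at hp ⊢
    obtain ⟨h1, h2⟩ := hp
    rw [← h2]
    exact h1.symm
  · rintro ⟨x1, y1⟩ hp ⟨x2, y2⟩ hq hpq
    simp only [Finset.coe_filter, Finset.mem_filter, Finset.mem_univ, true_and] at hp hq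
    obtain ⟨-, h1⟩ := hp
    obtain ⟨-, h2⟩ := hq
    simp_all

open Classical in
lemma card_embedding_two_le {α β : Type*} [Fintype α] {a : α → β} {D : ℕ} (h : ∀ b, occ a b ≤ D) :
    (Finset.univ.filter fun e : Fin 2 ↪ α => (a ∘ e) 0 = (a ∘ e) 1).card
      ≤ Fintype.card α * D := by
  refine le_trans (Finset.card_le_card_of_injOn (fun e => (e 0, e 1)) ?_ ?_) (card_pairs_le h)
  · intro e he
    simpa using he
  · intro e _ e' _ hee
    ext i
    fin_cases i
    · exact (Prod.ext_iff.1 hee).1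
    · exact (Prod.ext_iff.1 hee).2

open Classical in
lemma card_embedding_four_le {α β : Type*} [Fintype α] {a : α → β} {D : ℕ}
    (h : ∀ b, occ a b ≤ D) :
    (Finset.univ.filter fun e : Fin 4 ↪ α =>
        (a ∘ e) 0 = (a ∘ e) 1 ∧ (a ∘ e) 2 = (a ∘ e) 3).card ≤ (Fintype.card α * D) ^ 2 := by
  rw [sq]
  refine le_trans ?_ (Nat.mul_le_mul (card_pairs_le h) (card_pairs_le h))
  rw [← Finset.card_product]
  refine Finset.card_le_card_of_injOn (fun e => ((e 0, e 1), (e 2, e 3))) ?_ ?_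
  · intro e he
    simpa using he
  · intro e _ e' _ hee
    simp only [Prod.mk.injEq] at hee
    ext i
    fin_cases i
    · exact hee.1.1
    · exact hee.1.2
    · exact hee.2.1
    · exact hee.2.2

open Classical in
/-- The indices of loops and multiple edges. -/
noncomputable def badIdx {m n : ℕ} (a : Fin m × Bool → Fin n) : Finset (Fin m) :=
  Finset.univ.filter fun j => (wordEdge a j).IsDiag ∨ ∃ j', j ≠ j' ∧ wordEdge a j = wordEdge a j'

lemma simpleOn_compl_badIdx {m n : ℕ} (a : Fin m × Bool → Fin n) :
    SimpleOn a ((badIdx a : Set (Fin m))ᶜ) := by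
  have hm : ∀ j, j ∈ ((badIdx a : Set (Fin m))ᶜ) ↔
      ¬ (wordEdge a j).IsDiag ∧ ∀ j', j ≠ j' → wordEdge a j ≠ wordEdge a j' := fun j => by
    simp [badIdx]
  refine ⟨fun j hj => ((hm j).1 hj).1, fun j hj j' _ h => ?_⟩
  by_contra hne
  exact ((hm j).1 hj).2 j' hne h

open Classical in
lemma card_badIdx_le {m n : ℕ} (a : Fin m × Bool → Fin n) :
    (badIdx a).card ≤ (Finset.univ.filter fun j => (wordEdge a j).IsDiag).card
      + (Finset.univ.filter fun p : Fin m × Fin m =>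
          p.1 ≠ p.2 ∧ wordEdge a p.1 = wordEdge a p.2).card := by
  have h1 : badIdx a ⊆ (Finset.univ.filter fun j => (wordEdge a j).IsDiag)
      ∪ (Finset.univ.filter fun p : Fin m × Fin m =>
          p.1 ≠ p.2 ∧ wordEdge a p.1 = wordEdge a p.2).image Prod.fst := by
    intro j hj
    simp only [badIdx, Finset.mem_filter, Finset.mem_univ, true_and] at hj
    simp only [Finset.mem_union, Finset.mem_filter, Finset.mem_univ, true_and, Finset.mem_image]
    rcases hj with h | ⟨j', h1, h2⟩
    · exact Or.inl h
    · exact Or.inr ⟨(j, j'), ⟨h1, h2⟩, rfl⟩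
  refine (Finset.card_le_card h1).trans ((Finset.card_union_le _ _).trans ?_)
  exact Nat.add_le_add_left Finset.card_image_le _

section

variable {m n D : ℕ} {W : Finset (Fin m × Bool → Fin n)}

open Classical in
-- Among ordered pairs of distinct positions, at most `2m * D` out of `2m * (2m - 1)` carry equal
-- letters, so edge `j` is a loop in a proportion at most `D / m` of `W`.
lemma card_loop_mul_le (hm : 1 ≤ m) (hW : ∀ a ∈ W, ∀ τ : Equiv.Perm (Fin m × Bool), a ∘ τ ∈ W)
    (hD : ∀ a ∈ W, ∀ v, occ a v ≤ D) (j : Fin m) :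
    (W.filter fun a => (wordEdge a j).IsDiag).card * m ≤ W.card * D := by
  have hcard : Fintype.card (Fin m × Bool) = 2 * m := by simp [mul_comm]
  let e₀ : Fin 2 ↪ Fin m × Bool := ⟨![(j, false), (j, true)], by
    intro x y; fin_cases x <;> fin_cases y <;> simp⟩
  have h := card_filter_mul_descFactorial_le hW (fun f : Fin 2 → Fin n => f 0 = f 1)
    (fun a ha => card_embedding_two_le (hD a ha)) e₀
  replace h : (W.filter fun a => (wordEdge a j).IsDiag).card * (2 * m).descFactorial 2
      ≤ W.card * (2 * m * D) := by
    rw [hcard] at h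
    refine le_of_eq_of_le ?_ h
    congr 2
    ext a
    simp only [Finset.mem_filter]
    exact Iff.rfl
  set x := (W.filter fun a => (wordEdge a j).IsDiag).card
  have h3 : (2 * m).descFactorial 2 = 2 * m * (2 * m - 1) := by
    simp [Nat.descFactorial, mul_comm]
  rw [h3] at h
  have h4 : (2 * m) * (x * m) ≤ (2 * m) * (W.card * D) := by
    calc (2 * m) * (x * m) ≤ (2 * m) * (x * (2 * m - 1)) := by gcongr; omega
      _ = x * (2 * m * (2 * m - 1)) := by ring
      _ ≤ W.card * (2 * m * D) := h
      _ = _ := by ring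
  exact Nat.le_of_mul_le_mul_left h4 (by omega)

lemma mul_sq_le_of_mul_descFactorial_le (hm : 3 ≤ m) {x w : ℕ}
    (h : x * (2 * m).descFactorial 4 ≤ w * (2 * m * D) ^ 2) : x * m ^ 2 ≤ 2 * (w * D ^ 2) := by
  -- This is where `m ≥ 3` enters: the smallest factor `2m - 3` must be at least `m`.
  have h3 : 2 * m ^ 4 ≤ (2 * m).descFactorial 4 := by
    have : (2 * m).descFactorial 4 = (2 * m - 3) * ((2 * m - 2) * ((2 * m - 1) * (2 * m))) := by
      simp [Nat.descFactorial]
    rw [this]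
    calc 2 * m ^ 4 = m * (m * (m * (2 * m))) := by ring
      _ ≤ _ := by gcongr <;> omega
  have h4 : (2 * m ^ 2) * (x * m ^ 2) ≤ (2 * m ^ 2) * (2 * (w * D ^ 2)) := by
    calc (2 * m ^ 2) * (x * m ^ 2) = x * (2 * m ^ 4) := by ring
      _ ≤ x * (2 * m).descFactorial 4 := by gcongr
      _ ≤ w * (2 * m * D) ^ 2 := h
      _ = _ := by ring
  exact Nat.le_of_mul_le_mul_left h4 (by positivity)

open Classical in
-- Two edges coincide in one of two orientations. Each imposes two equalities among four distinct
-- positions and has proportion at most `2 * D^2 / m^2`.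
lemma card_double_mul_le (hm : 3 ≤ m)
    (hW : ∀ a ∈ W, ∀ τ : Equiv.Perm (Fin m × Bool), a ∘ τ ∈ W)
    (hD : ∀ a ∈ W, ∀ v, occ a v ≤ D) {j j' : Fin m} (hj : j ≠ j') :
    (W.filter fun a => wordEdge a j = wordEdge a j').card * m ^ 2 ≤ 4 * (W.card * D ^ 2) := by
  have hcard : Fintype.card (Fin m × Bool) = 2 * m := by simp [mul_comm]
  have key : ∀ b : Bool, (W.filter fun a => a (j, false) = a (j', b) ∧
      a (j, true) = a (j', !b)).card * m ^ 2 ≤ 2 * (W.card * D ^ 2) := by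
    intro b
    let e₀ : Fin 4 ↪ Fin m × Bool := ⟨![(j, false), (j', b), (j, true), (j', !b)], by
      intro x y
      fin_cases x <;> fin_cases y <;> simp [hj, hj.symm]⟩
    have h := card_filter_mul_descFactorial_le hW
      (fun f : Fin 4 → Fin n => f 0 = f 1 ∧ f 2 = f 3)
      (C := (Fintype.card (Fin m × Bool) * D) ^ 2)
      (fun a ha => by convert card_embedding_four_le (hD a ha)) e₀
    rw [hcard] at h
    refine mul_sq_le_of_mul_descFactorial_le hm (le_of_eq_of_le ?_ h)
    congr 2
    ext a
    simp only [Finset.mem_filter]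
    exact Iff.rfl
  have hsub : (W.filter fun a => wordEdge a j = wordEdge a j')
      ⊆ (W.filter fun a => a (j, false) = a (j', false) ∧ a (j, true) = a (j', !false))
        ∪ (W.filter fun a => a (j, false) = a (j', true) ∧ a (j, true) = a (j', !true)) := by
    intro a ha
    rw [Finset.mem_filter, wordEdge, wordEdge, Sym2.eq_iff] at ha
    simp only [Finset.mem_union, Finset.mem_filter]
    rcases ha with ⟨h1, h2 | h2⟩
    · exact Or.inl ⟨h1, h2⟩
    · exact Or.inr ⟨h1, h2⟩
  have h1 := (Finset.card_le_card hsub).trans (Finset.card_union_le _ _)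
  have h2 := Nat.mul_le_mul_right (m ^ 2) h1
  rw [add_mul] at h2
  have := key false
  have := key true
  omega

open Classical in
/-- Most words of an invariant family with bounded degrees have few loops and multiple edges. -/
lemma card_le_two_mul_card_badIdx_le (hm : 3 ≤ m)
    (hW : ∀ a ∈ W, ∀ τ : Equiv.Perm (Fin m × Bool), a ∘ τ ∈ W)
    (hD : ∀ a ∈ W, ∀ v, occ a v ≤ D) :
    W.card ≤ 2 * (W.filter fun a => (badIdx a).card ≤ 2 * (D + 4 * D ^ 2)).card := by
  -- First moment: `m` possible loops at proportion `D / m`, and `m^2` ordered pairs of edges at `4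
  -- * D^2 / m^2`. Markov's inequality at twice this mean keeps half of `W`.
  have h1 : ∑ a ∈ W, (badIdx a).card ≤ W.card * (D + 4 * D ^ 2) := by
    have hl : ∑ a ∈ W, (Finset.univ.filter fun j => (wordEdge a j).IsDiag).card ≤ W.card * D := by
      refine (Finset.sum_card_bipartiteAbove_eq_sum_card_bipartiteBelow
        (fun (a : Fin m × Bool → Fin n) (j : Fin m) => (wordEdge a j).IsDiag)).trans_le ?_
      unfold Finset.bipartiteBelow
      have h2 : ∀ j ∈ (Finset.univ : Finset (Fin m)),
          (W.filter fun a => (wordEdge a j).IsDiag).card * m ≤ W.card * D :=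
        fun j _ => card_loop_mul_le (by omega) hW hD j
      have h3 := Finset.sum_le_card_nsmul _ _ _ h2
      rw [← Finset.sum_mul, Finset.card_univ, Fintype.card_fin, smul_eq_mul, mul_comm m] at h3
      exact Nat.le_of_mul_le_mul_right h3 (by omega)
    have hd : ∑ a ∈ W, (Finset.univ.filter fun p : Fin m × Fin m =>
          p.1 ≠ p.2 ∧ wordEdge a p.1 = wordEdge a p.2).card ≤ 4 * (W.card * D ^ 2) := by
      refine (Finset.sum_card_bipartiteAbove_eq_sum_card_bipartiteBelow
        (fun (a : Fin m × Bool → Fin n) (p : Fin m × Fin m) =>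
          p.1 ≠ p.2 ∧ wordEdge a p.1 = wordEdge a p.2)).trans_le ?_
      unfold Finset.bipartiteBelow
      have h2 : ∀ p ∈ (Finset.univ : Finset (Fin m × Fin m)),
          (W.filter fun a => p.1 ≠ p.2 ∧ wordEdge a p.1 = wordEdge a p.2).card * m ^ 2
            ≤ 4 * (W.card * D ^ 2) := by
        intro p _
        by_cases hp : p.1 = p.2
        · simp [hp]
        · refine le_trans (Nat.mul_le_mul_right _ (Finset.card_le_card ?_))
            (card_double_mul_le hm hW hD hp)
          intro a ha
          rw [Finset.mem_filter] at ha ⊢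
          exact ⟨ha.1, ha.2.2⟩
      have h3 := Finset.sum_le_card_nsmul _ _ _ h2
      rw [← Finset.sum_mul, Finset.card_univ, Fintype.card_prod, Fintype.card_fin, smul_eq_mul,
        ← sq, mul_comm (m ^ 2)] at h3
      exact Nat.le_of_mul_le_mul_right h3 (by positivity)
    calc _ ≤ _ := Finset.sum_le_sum fun a _ => card_badIdx_le a
      _ = _ := Finset.sum_add_distrib
      _ ≤ W.card * D + 4 * (W.card * D ^ 2) := add_le_add hl hd
      _ = _ := by ring
  set s := D + 4 * D ^ 2
  have h2 : (W.filter fun a => ¬ (badIdx a).card ≤ 2 * s).card * (2 * s + 1)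
      ≤ W.card * s := by
    refine le_trans ?_ h1
    rw [← smul_eq_mul]
    refine le_trans ?_ (Finset.sum_le_sum_of_subset
      (Finset.filter_subset (fun a => ¬ (badIdx a).card ≤ 2 * s) W))
    refine Finset.card_nsmul_le_sum _ _ _ fun a ha => ?_
    have := (Finset.mem_filter.1 ha).2
    omega
  have h3 := Finset.card_filter_add_card_filter_not (s := W)
    (fun a => (badIdx a).card ≤ 2 * s)
  nlinarith

end

/-- Loops and multiple edges can be replaced by new edges. -/
lemma exists_simpleOn_univ {m n : ℕ} (hmn : m ≤ n.choose 2) {a : Fin m × Bool → Fin n}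
    {J : Finset (Fin m)} (ha : SimpleOn a ((J : Set (Fin m))ᶜ)) :
    ∃ a' : Fin m × Bool → Fin n, SimpleOn a' Set.univ ∧ ∀ j ∉ J, ∀ b, a' (j, b) = a (j, b) := by
  classical
  set E : Finset (Sym2 (Fin n)) := Finset.univ.filter fun e => ¬ e.IsDiag
  have hE : E.card = n.choose 2 := by
    rw [← Fintype.card_subtype, Sym2.card_subtype_not_diag, Fintype.card_fin]
  set T := (Jᶜ).image (wordEdge a)
  have hT : T.card ≤ m - J.card := by
    refine Finset.card_image_le.trans ?_
    rw [Finset.card_compl, Fintype.card_fin]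
  have hJ : J.card ≤ m := by simpa using Finset.card_le_univ J
  -- At most `m - |J|` edges are kept, so `m ≤ n.choose 2` leaves at least `|J|` unused pairs.
  have hle : Fintype.card J ≤ Fintype.card (E \ T : Finset _) := by
    rw [Fintype.card_coe, Fintype.card_coe]
    have := Finset.le_card_sdiff T E
    omega
  obtain ⟨g⟩ := Function.Embedding.nonempty_of_card_le hle
  have hg : ∀ x : J, (g x : Sym2 (Fin n)) ∈ E ∧ (g x : Sym2 (Fin n)) ∉ T :=
    fun x => Finset.mem_sdiff.1 (g x).2
  set e : Fin m → Sym2 (Fin n) := fun j => if h : j ∈ J then g ⟨j, h⟩ else wordEdge a j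
  have heJ : ∀ j (h : j ∈ J), e j = g ⟨j, h⟩ := fun j h => dif_pos h
  have heJ' : ∀ j, j ∉ J → e j = wordEdge a j := fun j h => dif_neg h
  set a' : Fin m × Bool → Fin n := fun p =>
    if p.1 ∈ J then (if p.2 then (e p.1).out.2 else (e p.1).out.1) else a p
  have hedge : wordEdge a' = e := by
    funext j
    by_cases h : j ∈ J
    · simp only [wordEdge, a', h, if_true]
      exact Quot.out_eq (e j)
    · rw [heJ' j h]
      simp [wordEdge, a', h]
  refine ⟨a', ⟨fun j _ => ?_, ?_⟩, fun j hj b => by simp [a', hj]⟩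
  · rw [hedge]
    by_cases h : j ∈ J
    · rw [heJ j h]
      exact (Finset.mem_filter.1 (hg ⟨j, h⟩).1).2
    · rw [heJ' j h]
      exact ha.1 j (by simpa using h)
  · rw [hedge, Set.injOn_univ]
    intro j j' hjj
    by_cases h : j ∈ J <;> by_cases h' : j' ∈ J
    · rw [heJ j h, heJ j' h'] at hjj
      exact congrArg Subtype.val (g.injective (Subtype.ext hjj))
    · rw [heJ j h, heJ' j' h'] at hjj
      exact absurd (hjj ▸ Finset.mem_image_of_mem _ (by simpa using h')) (hg ⟨j, h⟩).2
    · rw [heJ' j h, heJ j' h'] at hjj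
      exact absurd (hjj ▸ Finset.mem_image_of_mem _ (by simpa using h)) (hg ⟨j', h'⟩).2
    · rw [heJ' j h, heJ' j' h'] at hjj
      exact ha.2 (by simpa using h) (by simpa using h') hjj

open Classical in
/-- Few words lead to the same simple word. -/
lemma card_badIdx_le_le {m n : ℕ} (hm : 1 ≤ m) (hmn : m ≤ n.choose 2) (B : ℕ)
    (X : Finset (Fin m × Bool → Fin n)) :
    (X.filter fun a => (badIdx a).card ≤ B).card
      ≤ (Finset.univ.filter fun a' : Fin m × Bool → Fin n => SimpleOn a' Set.univ ∧
          ∃ a ∈ X, ∃ J : Finset (Fin m), J.card ≤ B ∧ ∀ j ∉ J, ∀ b, a' (j, b) = a (j, b)).card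
        * (m * n ^ 2) ^ B := by
  set Y := (Finset.univ.filter fun a' : Fin m × Bool → Fin n => SimpleOn a' Set.univ ∧
          ∃ a ∈ X, ∃ J : Finset (Fin m), J.card ≤ B ∧ ∀ j ∉ J, ∀ b, a' (j, b) = a (j, b))
  -- Decoding: the original word is recovered from the repaired one and a list of `B` indices with
  -- their original endpoints, whence `(m * n^2)^B` preimages at most.
  set Φ : (Fin m × Bool → Fin n) × (Fin B → Fin m × Fin n × Fin n) → (Fin m × Bool → Fin n) :=
    fun q p => if h : ∃ i, (q.2 i).1 = p.1 then
      (if p.2 then (q.2 h.choose).2.2 else (q.2 h.choose).2.1) else q.1 p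
  have hsub : (X.filter fun a => (badIdx a).card ≤ B) ⊆ (Y ×ˢ Finset.univ).image Φ := by
    intro a ha
    obtain ⟨haX, haB⟩ := Finset.mem_filter.1 ha
    obtain ⟨a', ha', haa⟩ := exists_simpleOn_univ hmn (simpleOn_compl_badIdx a)
    set J := badIdx a
    -- A short list is padded with index `0`. Padding and repetitions are harmless, since every
    -- entry records the true endpoints in `a`.
    set g : Fin B → Fin m := fun i => if h : (i : ℕ) < J.card then J.equivFin.symm ⟨i, h⟩
      else ⟨0, hm⟩
    have hg : ∀ j ∈ J, ∃ i, g i = j := by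
      intro j hj
      have hlt := (J.equivFin ⟨j, hj⟩).2
      refine ⟨⟨J.equivFin ⟨j, hj⟩, hlt.trans_le haB⟩, ?_⟩
      simp [g]
    refine Finset.mem_image.2 ⟨(a', fun i => (g i, a (g i, false), a (g i, true))), ?_, ?_⟩
    · refine Finset.mem_product.2 ⟨?_, Finset.mem_univ _⟩
      exact Finset.mem_filter.2 ⟨Finset.mem_univ _, ha', a, haX, J, haB, haa⟩
    · funext ⟨j, b⟩
      simp only [Φ]
      split_ifs with h1 h2
      · rw [h1.choose_spec, h2]
      · rw [h1.choose_spec]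
        simp only [Bool.not_eq_true] at h2
        rw [h2]
      · exact haa j (fun hj => h1 (hg j hj)) b
  refine (Finset.card_le_card hsub).trans (Finset.card_image_le.trans ?_)
  rw [Finset.card_product]
  refine le_of_eq ?_
  congr 1
  simp [sq]

/-- Changing few edges changes few degrees. -/
lemma occ_occ_le {m n B : ℕ} {a a' : Fin m × Bool → Fin n} {J : Finset (Fin m)} (hJ : J.card ≤ B)
    (h : ∀ j ∉ J, ∀ b, a' (j, b) = a (j, b)) (r : ℕ) :
    occ (occ a') r ≤ occ (occ a) r + 4 * B := by
  classical
  set P : Finset (Fin m × Bool) := J ×ˢ Finset.univ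
  have hP : P.card ≤ 2 * B := by
    simp only [P, Finset.card_product, Finset.card_univ, Fintype.card_bool]
    omega
  -- Only letters that stand, before or after, at one of the at most `2B` changed positions can
  -- change their count.
  have heq : ∀ v, v ∉ P.image a ∪ P.image a' → occ a v = occ a' v := by
    intro v hv
    simp only [Finset.mem_union, Finset.mem_image, not_or, not_exists, not_and] at hv
    unfold occ
    congr 1
    ext p
    simp only [Finset.mem_filter, Finset.mem_univ, true_and]
    by_cases hp : p ∈ P
    · exact iff_of_false (hv.1 p hp) (hv.2 p hp)
    · rw [h p.1 (fun h' => hp (by simp [P, h'])) p.2]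
  have hsub : (Finset.univ.filter fun v => occ a' v = r)
      ⊆ (Finset.univ.filter fun v => occ a v = r) ∪ (P.image a ∪ P.image a') := by
    intro v hv
    by_cases hv' : v ∈ P.image a ∪ P.image a'
    · exact Finset.mem_union_right _ hv'
    · refine Finset.mem_union_left _ ?_
      simp only [Finset.mem_filter, Finset.mem_univ, true_and] at hv ⊢
      rw [heq v hv', hv]
  have h1 := Finset.card_le_card hsub
  have h2 : (P.image a ∪ P.image a').card ≤ 4 * B := by
    refine (Finset.card_union_le _ _).trans ?_
    have := Finset.card_image_le (s := P) (f := a)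
    have := Finset.card_image_le (s := P) (f := a')
    omega
  have h3 := Finset.card_union_le (Finset.univ.filter fun v => occ a v = r)
    (P.image a ∪ P.image a')
  have h4 : (Finset.univ.filter fun v => occ a' v = r).card
      ≤ (Finset.univ.filter fun v => occ a v = r).card + 4 * B := by omega
  unfold occ at *
  convert h4

lemma occ_comp_perm {α β : Type*} [Fintype α] (a : α → β) (τ : Equiv.Perm α) :
    occ (a ∘ τ) = occ a := by
  classical
  funext b
  unfold occ
  rw [← Fintype.card_subtype, ← Fintype.card_subtype]
  exact Fintype.card_congr (τ.subtypeEquiv fun _ => Iff.rfl)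

lemma occ_comp_of_injective {α β γ : Type*} [Fintype α] (a : α → β) {g : β → γ}
    (hg : Function.Injective g) (b : β) : occ (g ∘ a) (g b) = occ a b := by
  unfold occ
  congr 1
  ext p
  simp [hg.eq_iff]

lemma prod_comp_eq_prod_pow_occ {α : Type*} [Fintype α] (d : α → ℕ) {M : ℕ} (hd : ∀ v, d v < M)
    (g : ℕ → ℕ) : ∏ v, g (d v) = ∏ r ∈ Finset.range M, g r ^ occ d r := by
  classical
  rw [← Finset.prod_fiberwise_of_maps_to (s := Finset.univ) (t := Finset.range M) (g := d)
    (fun v _ => Finset.mem_range.2 (hd v))]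
  refine Finset.prod_congr rfl fun r _ => ?_
  rw [Finset.prod_congr rfl (g := fun _ => g r)
    (fun v hv => by rw [(Finset.mem_filter.1 hv).2]), Finset.prod_const]
  congr 1
  unfold occ
  congr

open Classical in
/-- A lower bound for the number of simple words whose degree statistics are close to `k`. -/
lemma factorial_mul_factorial_le {n m R : ℕ} (hm : 3 ≤ m) (hmn : m ≤ n.choose 2) {k : ℕ → ℕ}
    (hk : ∀ r, R + 1 ≤ r → k r = 0) (hk0 : ∑ r ∈ Finset.range (R + 1), k r = n)
    (hk1 : ∑ r ∈ Finset.range (R + 1), k r * r = 2 * m) {B : ℕ} (hB : B = 2 * (R + 4 * R ^ 2)) :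
    n.factorial * (2 * m).factorial ≤
      2 * ((Finset.univ.filter fun a : Fin m × Bool → Fin n => SimpleOn a Set.univ ∧
          ∀ r, occ (occ a) r ≤ k r + 4 * B ∧ k r ≤ occ (occ a) r + 4 * B).card
        * (m * n ^ 2) ^ B) * ((∏ r ∈ Finset.range (R + 1), (k r).factorial)
        * ∏ r ∈ Finset.range (R + 1), r.factorial ^ k r) := by
  have hcard : Fintype.card (Fin m × Bool) = 2 * m := by simp [mul_comm]
  -- First multinomial coefficient: degree sequences with profile `k`, as functions into the finite
  -- type of degrees at most `R`. The second, in `h1`, counts the words with a given degree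
  -- sequence.
  set D₀ : Finset (Fin n → Fin (R + 1)) := Finset.univ.filter fun f => occ f = fun i : Fin (R + 1) => k i
  set 𝒟 : Finset (Fin n → ℕ) := D₀.image fun f v => (f v : ℕ)
  have hDcard : 𝒟.card * ∏ r ∈ Finset.range (R + 1), (k r).factorial = n.factorial := by
    have h1 : 𝒟.card = D₀.card := by
      refine Finset.card_image_of_injective _ fun f f' h => ?_
      funext v
      exact Fin.ext (congrFun h v)
    have h2 := card_occ_eq_mul (α := Fin n) (k := fun i : Fin (R + 1) => k i)
      (by rw [Fin.sum_univ_eq_sum_range, hk0, Fintype.card_fin])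
    rw [Fin.prod_univ_eq_prod_range (fun r => (k r).factorial), Fintype.card_fin] at h2
    rw [h1, ← h2]
  have hD1 : ∀ d ∈ 𝒟, ∀ v, d v < R + 1 := by
    intro d hd v
    obtain ⟨f, -, rfl⟩ := Finset.mem_image.1 hd
    exact (f v).2
  have hD2 : ∀ d ∈ 𝒟, occ d = k := by
    intro d hd
    funext r
    by_cases hr : r < R + 1
    · obtain ⟨f, hf, rfl⟩ := Finset.mem_image.1 hd
      have hf := congrFun (Finset.mem_filter.1 hf).2 ⟨r, hr⟩
      rw [← hf]
      exact occ_comp_of_injective f Fin.val_injective ⟨r, hr⟩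
    · rw [hk r (not_lt.1 hr), occ_eq_zero_of_le (hD1 d hd) (not_lt.1 hr)]
  set X : Finset (Fin m × Bool → Fin n) := Finset.univ.filter fun a => occ a ∈ 𝒟
  set Q : ℕ := ∏ r ∈ Finset.range (R + 1), r.factorial ^ k r
  have h1 : ∀ d ∈ 𝒟, (2 * m).factorial
      ≤ 2 * Q * ((X.filter fun a => (badIdx a).card ≤ B).filter fun a => occ a = d).card := by
    intro d hd
    set W : Finset (Fin m × Bool → Fin n) := Finset.univ.filter fun a => occ a = d
    have hsum : ∑ v, d v = Fintype.card (Fin m × Bool) := by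
      have h := sum_comp_eq_sum_occ d (hD1 d hd) fun r => (r : ℝ)
      rw [hD2 d hd] at h
      rw [hcard, ← hk1]
      exact_mod_cast h
    have h2 := card_occ_eq_mul hsum
    rw [prod_comp_eq_prod_pow_occ d (hD1 d hd) Nat.factorial, hD2 d hd, hcard] at h2
    have h3 : W.card ≤ 2 * (W.filter fun a => (badIdx a).card ≤ 2 * (R + 4 * R ^ 2)).card := by
      refine card_le_two_mul_card_badIdx_le hm ?_ ?_
      · intro a ha τ
        simp only [W, Finset.mem_filter, Finset.mem_univ, true_and] at ha ⊢
        rw [occ_comp_perm, ha]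
      · intro a ha v
        simp only [W, Finset.mem_filter, Finset.mem_univ, true_and] at ha
        rw [ha]
        exact Nat.le_of_lt_succ (hD1 d hd v)
    have h4 : ((X.filter fun a => (badIdx a).card ≤ B).filter fun a => occ a = d)
        = W.filter fun a => (badIdx a).card ≤ 2 * (R + 4 * R ^ 2) := by
      ext a
      simp only [X, W, Finset.mem_filter, Finset.mem_univ, true_and, hB]
      constructor
      · rintro ⟨⟨-, h5⟩, h6⟩
        exact ⟨h6, h5⟩
      · rintro ⟨h6, h5⟩
        exact ⟨⟨h6 ▸ hd, h5⟩, h6⟩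
    rw [h4, ← h2]
    calc W.card * Q ≤ 2 * (W.filter fun a => (badIdx a).card ≤ 2 * (R + 4 * R ^ 2)).card * Q :=
          Nat.mul_le_mul_right _ h3
      _ = _ := by ring
  have h5 : 𝒟.card * (2 * m).factorial
      ≤ 2 * Q * (X.filter fun a => (badIdx a).card ≤ B).card := by
    have hmaps : ∀ a ∈ X.filter fun a => (badIdx a).card ≤ B, occ a ∈ 𝒟 := fun a ha =>
      (Finset.mem_filter.1 (Finset.mem_filter.1 ha).1).2
    rw [Finset.card_eq_sum_card_fiberwise hmaps, Finset.mul_sum, ← smul_eq_mul]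
    exact Finset.card_nsmul_le_sum _ _ _ h1
  have h6 := card_badIdx_le_le (by omega) hmn B X
  have h7 : (Finset.univ.filter fun a' : Fin m × Bool → Fin n => SimpleOn a' Set.univ ∧
          ∃ a ∈ X, ∃ J : Finset (Fin m), J.card ≤ B ∧ ∀ j ∉ J, ∀ b, a' (j, b) = a (j, b)).card
      ≤ (Finset.univ.filter fun a : Fin m × Bool → Fin n => SimpleOn a Set.univ ∧
          ∀ r, occ (occ a) r ≤ k r + 4 * B ∧ k r ≤ occ (occ a) r + 4 * B).card := by
    refine Finset.card_le_card fun a' ha' => ?_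
    simp only [Finset.mem_filter, Finset.mem_univ, true_and] at ha' ⊢
    obtain ⟨h8, a, ha, J, hJ, haa⟩ := ha'
    have hoc : occ (occ a) = k := hD2 _ (Finset.mem_filter.1 ha).2
    refine ⟨h8, fun r => ⟨?_, ?_⟩⟩
    · have := occ_occ_le hJ haa r
      rwa [hoc] at this
    · have := occ_occ_le hJ (fun j hj b => (haa j hj b).symm) r
      rwa [hoc] at this
  rw [← hDcard]
  set S := (Finset.univ.filter fun a : Fin m × Bool → Fin n => SimpleOn a Set.univ ∧
          ∀ r, occ (occ a) r ≤ k r + 4 * B ∧ k r ≤ occ (occ a) r + 4 * B).card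
  calc 𝒟.card * (∏ r ∈ Finset.range (R + 1), (k r).factorial) * (2 * m).factorial
      = 𝒟.card * (2 * m).factorial * ∏ r ∈ Finset.range (R + 1), (k r).factorial := by ring
    _ ≤ 2 * Q * (X.filter fun a => (badIdx a).card ≤ B).card
          * ∏ r ∈ Finset.range (R + 1), (k r).factorial := Nat.mul_le_mul_right _ h5
    _ ≤ 2 * Q * (S * (m * n ^ 2) ^ B) * ∏ r ∈ Finset.range (R + 1), (k r).factorial := by
        refine Nat.mul_le_mul_right _ (Nat.mul_le_mul_left _ (h6.trans ?_))
        exact Nat.mul_le_mul_right _ h7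
    _ = _ := by ring

/-! ### Stirling's formula and integer profiles -/

lemma tendsto_log_factorial_div :
    Tendsto (fun k : ℕ => (Real.log k.factorial - k * Real.log k + k) / k) atTop (𝓝 0) := by
  have h1 : Tendsto (fun k : ℕ => Real.log (Stirling.stirlingSeq k) / k) atTop (𝓝 0) :=
    (((Real.continuousAt_log (by positivity)).tendsto.comp
      Stirling.tendsto_stirlingSeq_sqrt_pi).div_atTop tendsto_natCast_atTop_atTop)
  have h2 : Tendsto (fun k : ℕ => Real.log k / (k : ℝ)) atTop (𝓝 0) :=
    (Real.isLittleO_log_id_atTop.tendsto_div_nhds_zero).comp tendsto_natCast_atTop_atTop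
  have h3 : Tendsto (fun k : ℕ => Real.log 2 / (k : ℝ)) atTop (𝓝 0) :=
    tendsto_const_nhds.div_atTop tendsto_natCast_atTop_atTop
  have h4 := h1.add ((h2.add h3).mul_const (1 / 2))
  simp only [add_zero, zero_mul] at h4
  refine h4.congr' ?_
  filter_upwards [eventually_ge_atTop 1] with k hk
  have hk : (0 : ℝ) < k := by exact_mod_cast hk
  rw [Stirling.log_stirlingSeq_formula, Real.log_mul (by norm_num) hk.ne',
    Real.log_div hk.ne' (Real.exp_pos 1).ne', Real.log_exp]
  field_simp
  ring

lemma tendsto_natCast_of_div {k : ℕ → ℕ} {κ : ℝ} (hκ : 0 < κ)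
    (h : Tendsto (fun n : ℕ => (k n : ℝ) / n) atTop (𝓝 κ)) : Tendsto k atTop atTop := by
  rw [← tendsto_natCast_atTop_iff (R := ℝ)]
  have := h.pos_mul_atTop hκ (tendsto_natCast_atTop_atTop (R := ℝ))
  refine this.congr' ?_
  filter_upwards [eventually_ge_atTop 1] with n hn
  have hn : (0 : ℝ) < n := by exact_mod_cast hn
  field_simp

/-- Stirling's formula on the exponential scale. -/
lemma tendsto_log_factorial {k : ℕ → ℕ} {κ : ℝ} (hκ : 0 < κ)
    (h : Tendsto (fun n : ℕ => (k n : ℝ) / n) atTop (𝓝 κ)) :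
    Tendsto (fun n : ℕ => (Real.log (k n).factorial - k n * Real.log n) / n) atTop
      (𝓝 (κ * Real.log κ - κ)) := by
  have hk := tendsto_natCast_of_div hκ h
  have h1 := (tendsto_log_factorial_div.comp hk).mul h
  have h2 := h.mul (h.log hκ.ne')
  have h3 := (h1.add h2).sub h
  rw [zero_mul, zero_add] at h3
  refine h3.congr' ?_
  filter_upwards [eventually_ge_atTop 1, hk.eventually_ge_atTop 1] with n hn hkn
  have hn : (0 : ℝ) < n := by exact_mod_cast hn
  have hkn : (0 : ℝ) < k n := by exact_mod_cast hkn
  simp only [Function.comp_apply]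
  rw [Real.log_div hkn.ne' hn.ne']
  field_simp
  ring

/-- Integer points close to multiples of a given distribution, with prescribed sums. -/
lemma exists_profile {c : ℝ} {m : ℕ → ℕ}
    (hm : Tendsto (fun n : ℕ => ((2 * m n : ℕ) : ℝ) / n) atTop (𝓝 c)) {S : ℕ} {κ : ℕ → ℝ}
    (hpos : ∀ r < S + 2, 0 < κ r)
    (h0 : ∑ r ∈ Finset.range (S + 2), κ r = 1) (h1 : ∑ r ∈ Finset.range (S + 2), κ r * r = c) :
    ∃ k : ℕ → ℕ → ℕ, (∀ n r, S + 2 ≤ r → k n r = 0) ∧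
      (∀ r < S + 2, Tendsto (fun n : ℕ => (k n r : ℝ) / n) atTop (𝓝 (κ r))) ∧
      ∀ᶠ n in atTop, ∑ r ∈ Finset.range (S + 2), k n r = n ∧
        ∑ r ∈ Finset.range (S + 2), k n r * r = 2 * m n := by
  -- Counts of degrees at least 2 are rounded down. The count of degree 1 is then forced by the
  -- degree sum, and that of degree 0 by the number of nodes. The truncated subtractions are
  -- eventually genuine because `κ 1` and `κ 0` are positive.
  set fl : ℕ → ℕ → ℕ := fun n i => ⌊κ (i + 2) * n⌋₊
  have hfl : ∀ i < S, Tendsto (fun n : ℕ => (fl n i : ℝ) / n) atTop (𝓝 (κ (i + 2))) := fun i hi =>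
    (tendsto_nat_floor_mul_div_atTop (hpos (i + 2) (by omega)).le).comp
      tendsto_natCast_atTop_atTop
  set s0 : ℕ → ℕ := fun n => ∑ i ∈ Finset.range S, fl n i
  set s1 : ℕ → ℕ := fun n => ∑ i ∈ Finset.range S, fl n i * (i + 2)
  have hs0 : Tendsto (fun n : ℕ => (s0 n : ℝ) / n) atTop
      (𝓝 (∑ i ∈ Finset.range S, κ (i + 2))) := by
    have := tendsto_finsetSum (Finset.range S) fun i hi => hfl i (Finset.mem_range.1 hi)
    refine this.congr fun n => ?_
    simp only [s0]
    rw [Nat.cast_sum, Finset.sum_div]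
  have hs1 : Tendsto (fun n : ℕ => (s1 n : ℝ) / n) atTop
      (𝓝 (∑ i ∈ Finset.range S, κ (i + 2) * (i + 2 : ℕ))) := by
    have := tendsto_finsetSum (Finset.range S) fun i hi =>
      (hfl i (Finset.mem_range.1 hi)).mul_const ((i + 2 : ℕ) : ℝ)
    refine this.congr fun n => ?_
    simp only [s1]
    rw [Nat.cast_sum, Finset.sum_div]
    refine Finset.sum_congr rfl fun i _ => ?_
    push_cast
    ring
  rw [Finset.sum_range_succ', Finset.sum_range_succ'] at h0 h1
  simp only [zero_add, Nat.cast_zero, mul_zero, add_zero, Nat.cast_one, mul_one] at h0 h1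
  have hκ1 : Tendsto (fun n : ℕ => (((2 * m n : ℕ) : ℝ) - s1 n) / n) atTop (𝓝 (κ 1)) := by
    have := hm.sub hs1
    rw [← h1] at this
    simp only [add_assoc, one_add_one_eq_two, add_sub_cancel_left] at this
    exact this.congr fun n => (sub_div _ _ _).symm
  have hev1 : ∀ᶠ n in atTop, s1 n ≤ 2 * m n := by
    filter_upwards [hκ1.eventually (lt_mem_nhds (hpos 1 (by omega))), eventually_ge_atTop 1]
      with n h hn
    have hn : (0 : ℝ) < n := by exact_mod_cast hn
    have := (div_pos_iff_of_pos_right hn).1 h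
    exact_mod_cast (sub_pos.1 this).le
  have hk1 : Tendsto (fun n : ℕ => ((2 * m n - s1 n : ℕ) : ℝ) / n) atTop (𝓝 (κ 1)) := by
    refine hκ1.congr' ?_
    filter_upwards [hev1] with n h
    rw [Nat.cast_sub h]
  have hκ0 : Tendsto (fun n : ℕ => ((n : ℝ) - ((2 * m n - s1 n : ℕ) + s0 n : ℕ)) / n) atTop
      (𝓝 (κ 0)) := by
    have h2 := (tendsto_const_nhds (x := (1 : ℝ))).sub (hk1.add hs0)
    have h3 : 1 - (κ 1 + ∑ i ∈ Finset.range S, κ (i + 2)) = κ 0 := by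
      rw [← h0]
      simp only [add_assoc, one_add_one_eq_two]
      ring
    rw [h3] at h2
    refine h2.congr' ?_
    filter_upwards [eventually_ge_atTop 1] with n hn
    have hn : (0 : ℝ) < n := by exact_mod_cast hn
    rw [Nat.cast_add]
    field_simp
  have hev0 : ∀ᶠ n in atTop, (2 * m n - s1 n) + s0 n ≤ n := by
    filter_upwards [hκ0.eventually (lt_mem_nhds (hpos 0 (by omega))), eventually_ge_atTop 1]
      with n h hn
    have hn : (0 : ℝ) < n := by exact_mod_cast hn
    have := (div_pos_iff_of_pos_right hn).1 h
    exact_mod_cast (sub_pos.1 this).le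
  refine ⟨fun n r => match r with
    | 0 => n - ((2 * m n - s1 n) + s0 n)
    | 1 => 2 * m n - s1 n
    | i + 2 => if i < S then fl n i else 0, ?_, ?_, ?_⟩
  · rintro n (_ | _ | i) hr
    · omega
    · omega
    · simp only
      rw [if_neg (by omega)]
  · rintro (_ | _ | i) hr
    · refine hκ0.congr' ?_
      filter_upwards [hev0] with n h
      rw [Nat.cast_sub h]
    · exact hk1
    · simp only
      have : i < S := by omega
      simp only [if_pos this]
      exact hfl i this
  · filter_upwards [hev0, hev1] with n h h'
    rw [Finset.sum_range_succ', Finset.sum_range_succ', Finset.sum_range_succ',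
      Finset.sum_range_succ']
    have e0 : ∑ i ∈ Finset.range S, (if i < S then fl n i else 0) = s0 n :=
      Finset.sum_congr rfl fun i hi => if_pos (Finset.mem_range.1 hi)
    have e1 : ∑ i ∈ Finset.range S, (if i < S then fl n i else 0) * (i + 1 + 1) = s1 n :=
      Finset.sum_congr rfl fun i hi => by rw [if_pos (Finset.mem_range.1 hi)]
    simp only [e0, e1]
    constructor <;> omega

/-! ### Approximation of distributions with mean `c` -/

lemma hasSum_mul_mass_of_relEnt {c : ℝ} (hc : 0 < c) {δ : ProbabilityMeasure ℕ}
    (h : relEnt c δ ≠ ∞) : HasSum (fun r : ℕ => r * mass δ r) (realMean δ) :=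
  (summable_mul_mass hc h).hasSum

/-- Convexity of `klFun` and its zero at 1: mixing with the reference law does not increase any
entropy term. -/
lemma entTerm_mix_le {c : ℝ} (hc : 0 < c) (r : ℕ) {x : ℝ} (hx : 0 ≤ x) {ε : ℝ} (h0 : 0 ≤ ε)
    (h1 : ε ≤ 1) : entTerm c r ((1 - ε) * x + ε * pois c r) ≤ entTerm c r x := by
  have hq := pois_pos hc r
  have hxq : 0 ≤ x / pois c r := by positivity
  unfold entTerm
  refine mul_le_mul_of_nonneg_left ?_ hq.le
  have h2 := InformationTheory.convexOn_klFun.2 (x := x / pois c r) hxq (y := 1)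
    (Set.mem_Ici.2 zero_le_one) (sub_nonneg.2 h1) h0 (by ring)
  simp only [smul_eq_mul, InformationTheory.klFun_one, mul_zero, add_zero, mul_one] at h2
  have h3 : ((1 - ε) * x + ε * pois c r) / pois c r = (1 - ε) * (x / pois c r) + ε := by
    field_simp
  rw [h3]
  refine h2.trans (mul_le_of_le_one_left (InformationTheory.klFun_nonneg hxq) (by linarith))

/-- Approximation by distributions that charge every point. -/
lemma exists_mass_pos {c : ℝ} (hc : 0 < c) {δ : ProbabilityMeasure ℕ} (hδ : relEnt c δ ≠ ∞)
    (hmean : realMean δ = c) {U : Set (ProbabilityMeasure ℕ)} (hU : U ∈ 𝓝 δ) :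
    ∃ δ' ∈ U, (∀ r, 0 < mass δ' r) ∧ HasSum (fun r : ℕ => mass δ' r * r) c ∧
      relEnt c δ' ≤ relEnt c δ := by
  set e : ℕ → ℝ := fun k => 1 / ((k : ℝ) + 1)
  have he0 : ∀ k, 0 < e k := fun k => by positivity
  have he1 : ∀ k, e k ≤ 1 := fun k => by
    simp only [e]
    rw [div_le_one (by positivity)]
    have : (0 : ℝ) ≤ k := by positivity
    linarith
  have he : Tendsto e atTop (𝓝 0) := tendsto_one_div_add_atTop_nhds_zero_nat
  -- The Poisson law of mean `c` is itself a competitor of mean `c`, so mixing a little of it in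
  -- preserves the mean and charges every point.
  set x : ℕ → ℕ → ℝ := fun k r => (1 - e k) * mass δ r + e k * pois c r
  have hx0 : ∀ k r, 0 < x k r := fun k r =>
    add_pos_of_nonneg_of_pos (mul_nonneg (sub_nonneg.2 (he1 k)) (mass_nonneg δ r))
      (mul_pos (he0 k) (pois_pos hc r))
  have hx1 : ∀ k, HasSum (x k) 1 := fun k => by
    have := ((hasSum_mass δ).mul_left (1 - e k)).add ((hasSum_pois c).mul_left (e k))
    rwa [mul_one, mul_one, sub_add_cancel] at this
  set μ : ℕ → ProbabilityMeasure ℕ := fun k => ofMass (x k) (fun r => (hx0 k r).le) (hx1 k)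
  have hμ : Tendsto μ atTop (𝓝 δ) := by
    refine tendsto_of_tendsto_mass fun r => ?_
    simp only [μ, mass_ofMass, x]
    have := ((tendsto_const_nhds (x := (1 : ℝ))).sub he).mul_const (mass δ r)
    have := this.add (he.mul_const (pois c r))
    simpa using this
  obtain ⟨k, hk⟩ := (hμ.eventually hU).exists
  refine ⟨μ k, hk, fun r => ?_, ?_, ?_⟩
  · simpa [μ] using hx0 k r
  · have h1 := ((hasSum_mul_mass_of_relEnt hc hδ).mul_left (1 - e k)).add
      ((hasSum_mul_pois c).mul_left (e k))
    rw [hmean, ← add_mul, sub_add_cancel, one_mul] at h1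
    refine h1.congr_fun fun r => ?_
    simp only [μ, mass_ofMass, x]
    ring
  · refine ENNReal.tsum_le_tsum fun r => ENNReal.ofReal_le_ofReal ?_
    simp only [μ, mass_ofMass, x]
    exact entTerm_mix_le hc r (mass_nonneg δ r) (he0 k).le (he1 k)

/-- Approximation by distributions with finite support. -/
lemma exists_finite_support {c : ℝ} (hc : 0 < c) {δ : ProbabilityMeasure ℕ}
    (hpos : ∀ r, 0 < mass δ r) (hmean : HasSum (fun r : ℕ => mass δ r * r) c) {b : ℝ}
    (hb : relEnt c δ < ENNReal.ofReal b) {U : Set (ProbabilityMeasure ℕ)} (hU : U ∈ 𝓝 δ) :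
    ∃ δ' ∈ U, ∃ S : ℕ, (∀ r < S + 2, 0 < mass δ' r) ∧ (∀ r, S + 2 ≤ r → mass δ' r = 0) ∧
      ∑ r ∈ Finset.range (S + 2), mass δ' r = 1 ∧
      ∑ r ∈ Finset.range (S + 2), mass δ' r * r = c ∧
      ∑ r ∈ Finset.range (S + 2), mass δ' r * Real.log (mass δ' r / pois c r) < b := by
  have hδ : relEnt c δ ≠ ∞ := hb.ne_top
  obtain ⟨ε, hε, s, hs⟩ := exists_forall_abs_mass_sub_lt hU
  -- The tail beyond `S + 1` is cut off; the mass at 1 is adjusted to restore the mean and then the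
  -- mass at 0 to restore the total. Both tend to the original positive masses.
  set y1 : ℕ → ℝ := fun S => c - ∑ i ∈ Finset.range S, mass δ (i + 2) * (i + 2 : ℕ)
  set y0 : ℕ → ℝ := fun S => 1 - y1 S - ∑ i ∈ Finset.range S, mass δ (i + 2)
  have hy1 : Tendsto y1 atTop (𝓝 (mass δ 1)) := by
    have h := ((hasSum_nat_add_iff' 2).2 hmean).tendsto_sum_nat
    have := (tendsto_const_nhds (x := c)).sub h
    simpa [y1, Finset.sum_range_succ] using this
  have hy0 : Tendsto y0 atTop (𝓝 (mass δ 0)) := by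
    have h := ((hasSum_nat_add_iff' 2).2 (hasSum_mass δ)).tendsto_sum_nat
    have := ((tendsto_const_nhds (x := (1 : ℝ))).sub hy1).sub h
    simp only [Finset.sum_range_succ, Finset.sum_range_zero, zero_add] at this
    convert this using 2
    ring
  set x : ℕ → ℕ → ℝ := fun S r => match r with
    | 0 => y0 S
    | 1 => y1 S
    | i + 2 => if i < S then mass δ (i + 2) else 0
  have hx : ∀ r, Tendsto (fun S => x S r) atTop (𝓝 (mass δ r)) := by
    rintro (_ | _ | i)
    · exact hy0
    · exact hy1
    · refine tendsto_const_nhds.congr' ?_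
      filter_upwards [eventually_gt_atTop i] with S hS
      simp only [x]
      rw [if_pos hS]
  have hsum : ∀ (f : ℕ → ℝ → ℝ) (S : ℕ), ∑ r ∈ Finset.range (S + 2), f r (x S r)
      = ∑ i ∈ Finset.range S, f (i + 2) (mass δ (i + 2)) + f 1 (y1 S) + f 0 (y0 S) := by
    intro f S
    rw [Finset.sum_range_succ', Finset.sum_range_succ']
    congr 2
    refine Finset.sum_congr rfl fun i hi => ?_
    simp only [x]
    rw [if_pos (Finset.mem_range.1 hi)]
  -- The added Poisson tail cancels the corrections in `entTerm`, so the left side is exactly `∑ x *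
  -- log (x / q)` over the truncated range.
  have hent : Tendsto (fun S => ∑ r ∈ Finset.range (S + 2), entTerm c r (x S r)
      + (1 - ∑ r ∈ Finset.range (S + 2), pois c r)) atTop
      (𝓝 (∑' r, entTerm c r (mass δ r))) := by
    have hE := (summable_entTerm hc hδ).hasSum
    have h1 := ((hasSum_nat_add_iff' 2).2 hE).tendsto_sum_nat
    have h2 := ((continuous_entTerm c 1).tendsto _).comp hy1
    have h3 := ((continuous_entTerm c 0).tendsto _).comp hy0
    have h4 := (hasSum_pois c).tendsto_sum_nat.comp (tendsto_add_atTop_nat 2)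
    have h5 := ((h1.add h2).add h3).add ((tendsto_const_nhds (x := (1 : ℝ))).sub h4)
    simp only [Finset.sum_range_succ, Finset.sum_range_zero, zero_add] at h5
    have e : ∑' r, entTerm c r (mass δ r) - (entTerm c 0 (mass δ 0) + entTerm c 1 (mass δ 1))
        + entTerm c 1 (mass δ 1) + entTerm c 0 (mass δ 0) + (1 - 1)
        = ∑' r, entTerm c r (mass δ r) := by ring
    rw [e] at h5
    refine h5.congr fun S => ?_
    rw [hsum (entTerm c) S]
    rfl
  have hb' : ∑' r, entTerm c r (mass δ r) < b := by
    rw [relEnt_eq_ofReal hc hδ] at hb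
    exact (ENNReal.ofReal_lt_ofReal_iff'.1 hb).1
  have hnear : ∀ᶠ S in atTop, ∀ r ∈ s, |x S r - mass δ r| < ε := by
    rw [Filter.eventually_all_finset]
    intro r _
    have := (hx r).eventually (Metric.ball_mem_nhds _ hε)
    filter_upwards [this] with S hS
    rwa [Real.dist_eq] at hS
  obtain ⟨S, hS0, hS1, hSb, hSs⟩ := ((hy0.eventually (lt_mem_nhds (hpos 0))).and
    ((hy1.eventually (lt_mem_nhds (hpos 1))).and
      ((hent.eventually (gt_mem_nhds hb')).and hnear))).exists
  have hxpos : ∀ r < S + 2, 0 < x S r := by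
    rintro (_ | _ | i) hr
    · exact hS0
    · exact hS1
    · simp only [x]
      rw [if_pos (by omega)]
      exact hpos _
  have hxz : ∀ r, S + 2 ≤ r → x S r = 0 := by
    rintro (_ | _ | i) hr
    · omega
    · omega
    · simp only [x]
      rw [if_neg (by omega)]
  have hx1 : ∑ r ∈ Finset.range (S + 2), x S r = 1 := by
    rw [hsum (fun _ t => t) S]
    simp only [y0]
    ring
  have hxs : HasSum (x S) 1 := by
    rw [← hx1]
    exact hasSum_sum_of_ne_finset_zero fun r hr => hxz r (by simpa using hr)
  have hx0 : ∀ r, 0 ≤ x S r := fun r => by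
    by_cases hr : r < S + 2
    · exact (hxpos r hr).le
    · exact (hxz r (not_lt.1 hr)).ge
  refine ⟨ofMass (x S) hx0 hxs, hs _ (by simpa using hSs), S, ?_, ?_, ?_, ?_, ?_⟩
  · simpa using hxpos
  · simpa using hxz
  · simpa using hx1
  · simp only [mass_ofMass]
    rw [hsum (fun r t => t * (r : ℝ)) S]
    simp only [y1]
    push_cast
    ring
  · simp only [mass_ofMass]
    refine lt_of_eq_of_lt ?_ hSb
    simp_rw [entTerm_eq hc]
    rw [Finset.sum_add_distrib, Finset.sum_sub_distrib, hx1]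
    ring

/-! ### Exponential rates and the two bounds -/

lemma eventually_le_choose {lam : ℕ → ℕ} {l : ℝ}
    (hlam : Tendsto (fun n : ℕ => (lam n : ℝ) / n) atTop (𝓝 l)) :
    ∀ᶠ n in atTop, lam n ≤ n.choose 2 := by
  have h1 := hlam.eventually (gt_mem_nhds (lt_add_one l))
  have h2 : Tendsto (fun n : ℕ => ((n : ℝ) - 1) / 2) atTop atTop :=
    (tendsto_atTop_add_const_right _ (-1) tendsto_natCast_atTop_atTop).atTop_div_const two_pos
  filter_upwards [h1, h2.eventually_ge_atTop (l + 1), eventually_ge_atTop 1] with n h1 h2 hn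
  have hn : (0 : ℝ) < n := by exact_mod_cast hn
  rw [div_lt_iff₀ hn] at h1
  have : (lam n : ℝ) ≤ n.choose 2 := by
    rw [Nat.cast_choose_two]
    nlinarith
  exact_mod_cast this

lemma tendsto_log_natCast_div : Tendsto (fun n : ℕ => Real.log n / (n : ℝ)) atTop (𝓝 0) :=
  (Real.isLittleO_log_id_atTop.tendsto_div_nhds_zero).comp tendsto_natCast_atTop_atTop

lemma tendsto_two_mul_div {lam : ℕ → ℕ} {c : ℝ}
    (hlam : Tendsto (fun n : ℕ => (lam n : ℝ) / n) atTop (𝓝 (c / 2))) :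
    Tendsto (fun n : ℕ => ((2 * lam n : ℕ) : ℝ) / n) atTop (𝓝 c) := by
  have := hlam.const_mul 2
  rw [mul_div_cancel₀ _ (two_ne_zero)] at this
  refine this.congr fun n => ?_
  push_cast
  ring

lemma eventually_exp_le_of_tendsto_log {f : ℕ → ℝ} {l b : ℝ} (hf : ∀ᶠ n in atTop, 0 < f n)
    (h : Tendsto (fun n : ℕ => Real.log (f n) / n) atTop (𝓝 l)) (hb : -b < l) :
    ∀ᶠ n : ℕ in atTop, Real.exp (-(n * b)) ≤ f n := by
  filter_upwards [hf, h.eventually (lt_mem_nhds hb), eventually_ge_atTop 1] with n h1 h2 hn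
  have hn : (0 : ℝ) < n := by exact_mod_cast hn
  rw [← Real.le_log_iff_exp_le h1]
  rw [lt_div_iff₀ hn] at h2
  linarith

lemma eventually_le_exp_of_tendsto_log {f : ℕ → ℝ} {l b : ℝ} (hf : ∀ᶠ n in atTop, 0 < f n)
    (h : Tendsto (fun n : ℕ => Real.log (f n) / n) atTop (𝓝 l)) (hb : l < b) :
    ∀ᶠ n : ℕ in atTop, f n ≤ Real.exp (n * b) := by
  filter_upwards [hf, h.eventually (gt_mem_nhds hb), eventually_ge_atTop 1] with n h1 h2 hn
  have hn : (0 : ℝ) < n := by exact_mod_cast hn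
  rw [← Real.log_le_iff_le_exp h1]
  rw [div_lt_iff₀ hn] at h2
  linarith

/-- The exponential rate of the number of words with given degree statistics. -/
lemma tendsto_log_word_count {c : ℝ} (hc : 0 < c) {lam : ℕ → ℕ}
    (hlam : Tendsto (fun n : ℕ => (lam n : ℝ) / n) atTop (𝓝 (c / 2))) {R : ℕ} {κ : ℕ → ℝ}
    (hpos : ∀ r < R, 0 < κ r) (h0 : ∑ r ∈ Finset.range R, κ r = 1)
    (h1 : ∑ r ∈ Finset.range R, κ r * r = c) {k : ℕ → ℕ → ℕ}
    (hk : ∀ r < R, Tendsto (fun n : ℕ => (k n r : ℝ) / n) atTop (𝓝 (κ r)))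
    (hkn : ∀ᶠ n in atTop, ∑ r ∈ Finset.range R, k n r = n) (B : ℕ) :
    Tendsto (fun n : ℕ => Real.log (n.factorial * (2 * lam n).factorial /
      (2 * (lam n * n ^ 2 : ℝ) ^ B * ((∏ r ∈ Finset.range R, ((k n r).factorial : ℝ))
        * ∏ r ∈ Finset.range R, (r.factorial : ℝ) ^ k n r) * (n : ℝ) ^ (2 * lam n))) / n) atTop
      (𝓝 (-∑ r ∈ Finset.range R, κ r * Real.log (κ r / pois c r))) := by
  have hn1 : Tendsto (fun n : ℕ => ((n : ℕ) : ℝ) / n) atTop (𝓝 1) := by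
    refine tendsto_const_nhds.congr' ?_
    filter_upwards [eventually_ge_atTop 1] with n hn
    have hn : (0 : ℝ) < n := by exact_mod_cast hn
    field_simp
  have t1 := tendsto_log_factorial (k := fun n => n) one_pos hn1
  have t2 := tendsto_log_factorial hc (tendsto_two_mul_div hlam)
  have t3 := tendsto_finsetSum (Finset.range R) fun r hr =>
    tendsto_log_factorial (hpos r (Finset.mem_range.1 hr)) (hk r (Finset.mem_range.1 hr))
  have t4 := tendsto_finsetSum (Finset.range R) fun r hr =>
    (hk r (Finset.mem_range.1 hr)).mul_const (Real.log r.factorial)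
  have t5 : Tendsto (fun n : ℕ => (Real.log 2 + B * Real.log (lam n * n ^ 2)) / (n : ℝ)) atTop
      (𝓝 0) := by
    have h2 : Tendsto (fun n : ℕ => Real.log 2 / (n : ℝ)) atTop (𝓝 0) :=
      tendsto_const_nhds.div_atTop tendsto_natCast_atTop_atTop
    have h3 : Tendsto (fun n : ℕ => Real.log ((lam n : ℝ) / n) / (n : ℝ)) atTop (𝓝 0) :=
      (hlam.log (by positivity)).div_atTop tendsto_natCast_atTop_atTop
    have h4 := h2.add ((h3.add (tendsto_log_natCast_div.const_mul 3)).const_mul (B : ℝ))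
    simp only [mul_zero, add_zero] at h4
    refine h4.congr' ?_
    filter_upwards [eventually_ge_atTop 1,
      (tendsto_natCast_of_div (by positivity) hlam).eventually_ge_atTop 1] with n hn hl
    have hn : (0 : ℝ) < n := by exact_mod_cast hn
    have hl : (0 : ℝ) < lam n := by exact_mod_cast hl
    rw [Real.log_div hl.ne' hn.ne', Real.log_mul hl.ne' (by positivity), Real.log_pow]
    field_simp
    push_cast
    ring
  -- The `log n` terms set aside by Stirling's formula cancel: `n + 2m` from the numerator against
  -- `∑ k = n` and the power `n^(2m)` in the denominator.
  have hlim := (((t1.add t2).sub t3).sub t4).sub t5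
  have e : 1 * Real.log 1 - 1 + (c * Real.log c - c)
      - ∑ r ∈ Finset.range R, (κ r * Real.log (κ r) - κ r)
      - ∑ r ∈ Finset.range R, κ r * Real.log r.factorial - 0
      = -∑ r ∈ Finset.range R, κ r * Real.log (κ r / pois c r) := by
    have e1 : ∀ r ∈ Finset.range R, κ r * Real.log (κ r / pois c r)
        = (κ r * Real.log (κ r) - κ r) + κ r * Real.log r.factorial + (1 + c) * κ r
          - Real.log c * (κ r * r) := by
      intro r hr
      rw [Real.log_div (hpos r (Finset.mem_range.1 hr)).ne' (pois_pos hc r).ne', log_pois hc]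
      ring
    rw [Finset.sum_congr rfl e1]
    simp only [Finset.sum_sub_distrib, Finset.sum_add_distrib, ← Finset.mul_sum, h0, h1,
      Real.log_one]
    ring
  rw [e] at hlim
  refine hlim.congr' ?_
  filter_upwards [eventually_ge_atTop 1, hkn,
    (tendsto_natCast_of_div (by positivity) hlam).eventually_ge_atTop 1] with n hn hkn hl
  have hn : (0 : ℝ) < n := by exact_mod_cast hn
  have hl : (0 : ℝ) < lam n := by exact_mod_cast hl
  have p1 : (0 : ℝ) < ∏ r ∈ Finset.range R, ((k n r).factorial : ℝ) :=
    Finset.prod_pos fun r _ => by positivity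
  have p2 : (0 : ℝ) < ∏ r ∈ Finset.range R, (r.factorial : ℝ) ^ k n r :=
    Finset.prod_pos fun r _ => by positivity
  have hden : Real.log (2 * (lam n * n ^ 2 : ℝ) ^ B * ((∏ r ∈ Finset.range R,
        ((k n r).factorial : ℝ)) * ∏ r ∈ Finset.range R, (r.factorial : ℝ) ^ k n r)
        * (n : ℝ) ^ (2 * lam n))
      = Real.log 2 + B * Real.log (lam n * n ^ 2)
        + (∑ r ∈ Finset.range R, Real.log ((k n r).factorial)
          + ∑ r ∈ Finset.range R, Real.log ((r.factorial : ℝ) ^ k n r))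
        + (2 * lam n : ℕ) * Real.log n := by
    rw [Real.log_mul (by positivity) (by positivity), Real.log_mul (by positivity) (by positivity),
      Real.log_mul p1.ne' p2.ne', Real.log_mul (by positivity) (by positivity),
      Real.log_prod (fun r _ => by positivity), Real.log_prod (fun r _ => by positivity),
      Real.log_pow, Real.log_pow]
  have hnum : Real.log (n.factorial * (2 * lam n).factorial)
      = Real.log n.factorial + Real.log (2 * lam n).factorial :=
    Real.log_mul (by positivity) (by positivity)
  rw [Real.log_div (by positivity) (by positivity), hnum, hden]
  have e2 : ∑ r ∈ Finset.range R, (Real.log (k n r).factorial - k n r * Real.log n) / n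
      = (∑ r ∈ Finset.range R, Real.log (k n r).factorial - n * Real.log n) / n := by
    rw [← Finset.sum_div, Finset.sum_sub_distrib, ← Finset.sum_mul, ← Nat.cast_sum, hkn]
  have e3 : ∑ r ∈ Finset.range R, (k n r : ℝ) / n * Real.log r.factorial
      = (∑ r ∈ Finset.range R, Real.log ((r.factorial : ℝ) ^ k n r)) / n := by
    rw [Finset.sum_div]
    refine Finset.sum_congr rfl fun r _ => ?_
    rw [Real.log_pow]
    ring
  rw [e2, e3]
  field_simp
  ring

/-- Simple words with counts within `4 * B` of the profile have empirical masses within `4 * B / n`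
of `k n r / n`. As `B` depends only on the support, they eventually fall in `U`, and their number
has the rate computed by Stirling's formula. -/
lemma eventually_exp_le_law_of_finite_support {c : ℝ} (hc : 0 < c) {lam : ℕ → ℕ}
    (hlam : Tendsto (fun n : ℕ => (lam n : ℝ) / n) atTop (𝓝 (c / 2))) (d : ℕ)
    {δ : ProbabilityMeasure ℕ} {S : ℕ} (hpos : ∀ r < S + 2, 0 < mass δ r)
    (hz : ∀ r, S + 2 ≤ r → mass δ r = 0) (h0 : ∑ r ∈ Finset.range (S + 2), mass δ r = 1)
    (h1 : ∑ r ∈ Finset.range (S + 2), mass δ r * r = c) {b : ℝ}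
    (hb : ∑ r ∈ Finset.range (S + 2), mass δ r * Real.log (mass δ r / pois c r) < b)
    {U : Set (ProbabilityMeasure ℕ)} (hU : U ∈ 𝓝 δ) :
    ∀ᶠ n : ℕ in atTop, ENNReal.ofReal (Real.exp (-(n * b)))
      ≤ law d n (lam n) (degreeDistribution ⁻¹' U) := by
  classical
  obtain ⟨k, hkz, hk, hksum⟩ := exists_profile (tendsto_two_mul_div hlam) hpos h0 h1
  obtain ⟨ε, hε, s, hs⟩ := exists_forall_abs_mass_sub_lt hU
  set B := 2 * ((S + 1) + 4 * (S + 1) ^ 2)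
  have hlim := tendsto_log_word_count hc hlam hpos h0 h1 hk (hksum.mono fun n h => h.1) B
  have hlamtop := tendsto_natCast_of_div (by positivity) hlam
  set L : ℕ → ℝ := fun n => n.factorial * (2 * lam n).factorial /
      (2 * (lam n * n ^ 2 : ℝ) ^ B * ((∏ r ∈ Finset.range (S + 2), ((k n r).factorial : ℝ))
        * ∏ r ∈ Finset.range (S + 2), (r.factorial : ℝ) ^ k n r) * (n : ℝ) ^ (2 * lam n))
  have hp1 : ∀ n, (0 : ℝ) < ∏ r ∈ Finset.range (S + 2), ((k n r).factorial : ℝ) := fun n =>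
    Finset.prod_pos fun r _ => by positivity
  have hp2 : ∀ n, (0 : ℝ) < ∏ r ∈ Finset.range (S + 2), (r.factorial : ℝ) ^ k n r := fun n =>
    Finset.prod_pos fun r _ => by positivity
  have hLpos : ∀ᶠ n in atTop, 0 < L n := by
    filter_upwards [eventually_ge_atTop 1, hlamtop.eventually_ge_atTop 1] with n hn hl
    have hn : (0 : ℝ) < n := by exact_mod_cast hn
    have hl : (0 : ℝ) < lam n := by exact_mod_cast hl
    have := hp1 n
    have := hp2 n
    simp only [L]
    positivity
  have hnear : ∀ᶠ n : ℕ in atTop, ∀ r ∈ s, |(k n r : ℝ) / n - mass δ r| < ε / 2 := by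
    rw [Filter.eventually_all_finset]
    intro r _
    by_cases hr : r < S + 2
    · have := (hk r hr).eventually (Metric.ball_mem_nhds _ (half_pos hε))
      filter_upwards [this] with n hn
      rwa [Real.dist_eq] at hn
    · refine Eventually.of_forall fun n => ?_
      rw [hkz n r (not_lt.1 hr), hz r (not_lt.1 hr)]
      simpa using hε
  have hB : ∀ᶠ n : ℕ in atTop, (4 * B : ℝ) / n < ε / 2 :=
    (tendsto_const_nhds.div_atTop tendsto_natCast_atTop_atTop).eventually
      (gt_mem_nhds (half_pos hε))
  filter_upwards [eventually_exp_le_of_tendsto_log hLpos hlim (neg_lt_neg hb), hnear, hB, hksum,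
    eventually_le_choose hlam, hlamtop.eventually_ge_atTop 3, eventually_ge_atTop 1]
    with n hL hnear hB hksum hch hl3 hn1
  have hn0 : n ≠ 0 := by omega
  have hn : (0 : ℝ) < n := by exact_mod_cast hn1
  have hl : (0 : ℝ) < lam n := by
    have : 0 < lam n := by omega
    exact_mod_cast this
  refine le_trans (ENNReal.ofReal_le_ofReal (hL.trans ?_)) (le_law_preimage hn0 hch U)
  have hcount := factorial_mul_factorial_le hl3 hch (k := k n) (R := S + 1) (hkz n) hksum.1
    hksum.2 (B := B) rfl
  set A := (Finset.univ.filter fun a : Fin (lam n) × Bool → Fin n => SimpleOn a Set.univ ∧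
          ∀ r, occ (occ a) r ≤ k n r + 4 * B ∧ k n r ≤ occ (occ a) r + 4 * B)
  have hA : A.card ≤ (Finset.univ.filter fun a : Fin (lam n) × Bool → Fin n =>
      SimpleOn a Set.univ ∧ empirical hn0 (occ a) ∈ U).card := by
    refine Finset.card_le_card fun a ha => ?_
    simp only [A, Finset.mem_filter, Finset.mem_univ, true_and] at ha ⊢
    refine ⟨ha.1, hs _ fun r hr => ?_⟩
    rw [mass_empirical]
    have h2 : |(occ (occ a) r : ℝ) / n - (k n r : ℝ) / n| ≤ (4 * B : ℝ) / n := by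
      rw [← sub_div, abs_div, abs_of_pos hn]
      refine div_le_div_of_nonneg_right ?_ hn.le
      have h3 : (occ (occ a) r : ℝ) ≤ k n r + 4 * B := by exact_mod_cast (ha.2 r).1
      have h4 : (k n r : ℝ) ≤ occ (occ a) r + 4 * B := by exact_mod_cast (ha.2 r).2
      rw [abs_le]
      constructor <;> linarith
    have h5 := hnear r hr
    have h6 := abs_sub_le ((occ (occ a) r : ℝ) / n) ((k n r : ℝ) / n) (mass δ r)
    linarith
  have hcount' : (n.factorial : ℝ) * (2 * lam n).factorial ≤
      2 * (A.card * (lam n * n ^ 2 : ℝ) ^ B) *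
        ((∏ r ∈ Finset.range (S + 2), ((k n r).factorial : ℝ))
        * ∏ r ∈ Finset.range (S + 2), (r.factorial : ℝ) ^ k n r) := by
    exact_mod_cast hcount
  have := hp1 n
  have := hp2 n
  calc L n ≤ (A.card : ℝ) / (n : ℝ) ^ (2 * lam n) := by
        simp only [L]
        rw [div_le_div_iff₀ (by positivity) (by positivity)]
        calc _ ≤ (2 * (A.card * (lam n * n ^ 2 : ℝ) ^ B) *
              ((∏ r ∈ Finset.range (S + 2), ((k n r).factorial : ℝ))
              * ∏ r ∈ Finset.range (S + 2), (r.factorial : ℝ) ^ k n r)) * (n : ℝ) ^ (2 * lam n) :=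
              mul_le_mul_of_nonneg_right hcount' (by positivity)
          _ = _ := by ring
    _ ≤ _ := by
        refine div_le_div_of_nonneg_right ?_ (by positivity)
        exact_mod_cast hA

lemma eventually_exp_le_law {c : ℝ} (hc : 0 < c) {lam : ℕ → ℕ}
    (hlam : Tendsto (fun n : ℕ => (lam n : ℝ) / n) atTop (𝓝 (c / 2))) (d : ℕ)
    {U : Set (ProbabilityMeasure ℕ)} (hU : IsOpen U) {δ : ProbabilityMeasure ℕ} (hδ : δ ∈ U)
    {b : ℝ≥0} (hb : rate c δ < b) :
    ∀ᶠ n : ℕ in atTop, ENNReal.ofReal (Real.exp (-(n * b)))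
      ≤ law d n (lam n) (degreeDistribution ⁻¹' U) := by
  obtain ⟨h1, h2⟩ := rate_eq hc hb.ne_top
  rw [h1] at hb
  obtain ⟨δ₁, hδ₁, hpos, hmean, hent⟩ := exists_mass_pos hc hb.ne_top h2 (hU.mem_nhds hδ)
  have hb' : relEnt c δ₁ < ENNReal.ofReal (b : ℝ) := by
    rw [ENNReal.ofReal_coe_nnreal]
    exact hent.trans_lt hb
  obtain ⟨δ₂, hδ₂, S, h3, h4, h5, h6, h7⟩ :=
    exists_finite_support hc hpos hmean hb' (hU.mem_nhds hδ₁)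
  exact eventually_exp_le_law_of_finite_support hc hlam d h3 h4 h5 h6 h7 (hU.mem_nhds hδ₂)

/-- The prefactor in the upper bound is subexponential, up to the choice of `x`. -/
lemma tendsto_log_prefactor {c : ℝ} (hc : 0 < c) {lam : ℕ → ℕ}
    (hlam : Tendsto (fun n : ℕ => (lam n : ℝ) / n) atTop (𝓝 (c / 2))) {x : ℝ} (hx : 0 < x) :
    (∀ᶠ n : ℕ in atTop, 0 < ((n : ℝ) + 1) * Real.exp (1 / (1 - x) ^ 2) / x ^ (2 * lam n)
        * ((2 * lam n).factorial * Real.exp (c * n) / c ^ (2 * lam n))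
        / (2 * ((n.choose 2 : ℝ) + 1 - lam n)) ^ lam n) ∧
    Tendsto (fun n : ℕ => Real.log (((n : ℝ) + 1) * Real.exp (1 / (1 - x) ^ 2) / x ^ (2 * lam n)
        * ((2 * lam n).factorial * Real.exp (c * n) / c ^ (2 * lam n))
        / (2 * ((n.choose 2 : ℝ) + 1 - lam n)) ^ lam n) / n) atTop (𝓝 (-(c * Real.log x))) := by
  have hchpos : ∀ᶠ n : ℕ in atTop, 0 < 2 * ((n.choose 2 : ℝ) + 1 - lam n) := by
    filter_upwards [eventually_le_choose hlam] with n h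
    have : (lam n : ℝ) ≤ n.choose 2 := by exact_mod_cast h
    linarith
  refine ⟨?_, ?_⟩
  · filter_upwards [hchpos] with n h
    positivity
  have hM := tendsto_two_mul_div hlam
  have hinv : Tendsto (fun n : ℕ => 1 / (n : ℝ)) atTop (𝓝 0) :=
    tendsto_const_nhds.div_atTop tendsto_natCast_atTop_atTop
  have t1 : Tendsto (fun n : ℕ => Real.log ((n : ℝ) + 1) / (n : ℝ)) atTop (𝓝 0) := by
    have h1 := ((hinv.const_add 1).log (by norm_num)).mul hinv
    have h2 := tendsto_log_natCast_div.add h1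
    simp only [mul_zero, add_zero] at h2
    refine h2.congr' ?_
    filter_upwards [eventually_ge_atTop 1] with n hn
    have hn : (0 : ℝ) < n := by exact_mod_cast hn
    have : (n : ℝ) + 1 = n * (1 + 1 / n) := by field_simp
    rw [this, Real.log_mul hn.ne' (by positivity)]
    field_simp
  have t2 : Tendsto (fun n : ℕ => (1 / (1 - x) ^ 2) / (n : ℝ)) atTop (𝓝 0) :=
    tendsto_const_nhds.div_atTop tendsto_natCast_atTop_atTop
  have t3 := hM.mul_const (Real.log x)
  have t4 := tendsto_log_factorial hc hM
  have t5 := hM.mul_const (Real.log c)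
  -- The denominator is `n^2` up to a factor tending to 1. Raised to the power `m = O(n)`, this
  -- factor is still subexponential.
  have t6 : Tendsto (fun n : ℕ => 2 * ((n.choose 2 : ℝ) + 1 - lam n) / (n : ℝ) ^ 2) atTop
      (𝓝 1) := by
    have h1 := ((tendsto_const_nhds (x := (1 : ℝ))).sub hinv).add
      (((hinv.mul hinv).const_mul 2).sub ((hlam.mul hinv).const_mul 2))
    simp only [mul_zero, sub_zero, add_zero] at h1
    refine h1.congr' ?_
    filter_upwards [eventually_ge_atTop 1] with n hn
    have hn : (0 : ℝ) < n := by exact_mod_cast hn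
    rw [Nat.cast_choose_two]
    field_simp
    ring
  have t7 := hlam.mul (t6.log one_ne_zero)
  have hlim := ((((t1.add t2).sub t3).add t4).add (tendsto_const_nhds (x := c))).sub (t5.add t7)
  have e : 0 + 0 - c * Real.log x + (c * Real.log c - c) + c
      - (c * Real.log c + c / 2 * Real.log 1) = -(c * Real.log x) := by
    rw [Real.log_one]; ring
  rw [e] at hlim
  refine hlim.congr' ?_
  filter_upwards [hchpos, eventually_ge_atTop 1] with n hch hn
  have hn : (0 : ℝ) < n := by exact_mod_cast hn
  have e1 : Real.log (((n : ℝ) + 1) * Real.exp (1 / (1 - x) ^ 2) / x ^ (2 * lam n))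
      = Real.log ((n : ℝ) + 1) + 1 / (1 - x) ^ 2 - (2 * lam n : ℕ) * Real.log x := by
    rw [Real.log_div (by positivity) (by positivity), Real.log_mul (by positivity) (by positivity),
      Real.log_exp, Real.log_pow]
  have e2 : Real.log ((2 * lam n).factorial * Real.exp (c * n) / c ^ (2 * lam n))
      = Real.log (2 * lam n).factorial + c * n - (2 * lam n : ℕ) * Real.log c := by
    rw [Real.log_div (by positivity) (by positivity), Real.log_mul (by positivity) (by positivity),
      Real.log_exp, Real.log_pow]
  generalize 2 * ((n.choose 2 : ℝ) + 1 - lam n) = y at hch ⊢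
  have e3 : Real.log (((n : ℝ) + 1) * Real.exp (1 / (1 - x) ^ 2) / x ^ (2 * lam n)
      * ((2 * lam n).factorial * Real.exp (c * n) / c ^ (2 * lam n)) / y ^ lam n)
      = Real.log ((n : ℝ) + 1) + 1 / (1 - x) ^ 2 - (2 * lam n : ℕ) * Real.log x
        + (Real.log (2 * lam n).factorial + c * n - (2 * lam n : ℕ) * Real.log c)
        - lam n * Real.log y := by
    rw [Real.log_div (by positivity) (by positivity), Real.log_mul (by positivity) (by positivity),
      e1, e2, Real.log_pow]
  rw [e3, Real.log_div hch.ne' (by positivity), Real.log_pow]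
  generalize 1 / (1 - x) ^ 2 = z
  field_simp
  push_cast
  ring

/-- The gap between `b` and `a` pays for the factor `x^(-2m)` lost in counting types with a fixed `x
< 1`. -/
lemma eventually_law_le_exp {c : ℝ} (hc : 0 < c) {lam : ℕ → ℕ}
    (hlam : Tendsto (fun n : ℕ => (lam n : ℝ) / n) atTop (𝓝 (c / 2))) (d : ℕ)
    {F : Set (ProbabilityMeasure ℕ)} (hF : IsClosed F) {a b : ℝ≥0} (hba : b < a)
    (ha : ∀ δ ∈ F, (a : ℝ≥0∞) < rate c δ) :
    ∀ᶠ n : ℕ in atTop, law d n (lam n) (degreeDistribution ⁻¹' F)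
      ≤ ENNReal.ofReal (Real.exp (-(n * b))) := by
  classical
  obtain ⟨ε, hε, hent⟩ := exists_relEnt_gt hc hF a ha
  have hba' : (0 : ℝ) < a - b := sub_pos.2 (by exact_mod_cast hba)
  -- Chosen so that the loss `-(c * log x)` equals `(a - b) / 2`.
  set x : ℝ := Real.exp (-((a - b) / (2 * c)))
  have hx0 : 0 < x := Real.exp_pos _
  have hx1 : x < 1 := by
    rw [Real.exp_lt_one_iff]
    have : 0 < (a - b) / (2 * c) := by positivity
    linarith
  have hlogx : -(c * Real.log x) < a - b := by
    simp only [x, Real.log_exp]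
    field_simp
    linarith
  obtain ⟨hpos, hlim⟩ := tendsto_log_prefactor hc hlam hx0
  have hmean := (tendsto_two_mul_div hlam).eventually (Metric.ball_mem_nhds c hε)
  have ha0 : (0 : ℝ) < a := lt_of_le_of_lt b.2 (by exact_mod_cast hba)
  filter_upwards [eventually_le_exp_of_tendsto_log hpos hlim hlogx, hmean,
    eventually_le_choose hlam, eventually_ge_atTop 1] with n hpre hmean hch hn
  have hn0 : n ≠ 0 := by omega
  refine (law_preimage_le hn0 hch F).trans (ENNReal.ofReal_le_ofReal ?_)
  have hcount := card_word_le hc hn0 (lam n) F ha0 (fun δ hδ hδF => ?_) hx0 hx1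
  · have hchpos : 0 < 2 * ((n.choose 2 : ℝ) + 1 - lam n) := by
      have : (lam n : ℝ) ≤ n.choose 2 := by exact_mod_cast hch
      linarith
    refine (div_le_div_of_nonneg_right hcount (by positivity)).trans ?_
    rw [mul_div_right_comm]
    refine (mul_le_mul_of_nonneg_right hpre (Real.exp_nonneg _)).trans ?_
    rw [← Real.exp_add]
    refine Real.exp_le_exp.2 (le_of_eq ?_)
    ring
  · rw [ENNReal.ofReal_coe_nnreal]
    -- Every degree distribution in play has mean exactly `2m/n`, eventually within `ε` of `c`.
    refine (hent _ hδF ?_).le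
    rw [realMean_empirical, mem_seqs.1 hδ]
    rwa [Real.dist_eq] at hmean

/-! ### From exponential bounds to the large deviation principle -/

lemma log_ofReal_exp_div (n : ℕ) (hn : 1 ≤ n) (b : ℝ) :
    ENNReal.log (ENNReal.ofReal (Real.exp (-(n * b)))) / (n : EReal) = ((-b : ℝ) : EReal) := by
  have hn' : (n : ℝ) ≠ 0 := by positivity
  rw [ENNReal.log_ofReal_of_pos (Real.exp_pos _), Real.log_exp,
    show (n : EReal) = ((n : ℝ) : EReal) from rfl, ← EReal.coe_div]
  congr 1
  field_simp

/-- A criterion for the large deviation principle. -/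
lemma satisfiesGoodLDP_of_eventually {Ω : ℕ → Type*} [∀ n, MeasurableSpace (Ω n)] {E : Type*}
    [TopologicalSpace E] {P : (n : ℕ) → Measure (Ω n)} {Y : (n : ℕ) → Ω n → E} {I : E → ℝ≥0∞}
    (hclosed : ∀ a : ℝ≥0, IsClosed {x : E | I x ≤ a})
    (hcompact : ∀ a : ℝ≥0, IsCompact {x : E | I x ≤ a})
    (hone : ∀ F : Set E, ∀ᶠ n in atTop, P n (Y n ⁻¹' F) ≤ 1)
    (hupper : ∀ F : Set E, IsClosed F → ∀ a b : ℝ≥0, b < a → (∀ x ∈ F, (a : ℝ≥0∞) < I x) →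
      ∀ᶠ n : ℕ in atTop, P n (Y n ⁻¹' F) ≤ ENNReal.ofReal (Real.exp (-(n * b))))
    (hlower : ∀ U : Set E, IsOpen U → ∀ x ∈ U, ∀ b : ℝ≥0, I x < b →
      ∀ᶠ n : ℕ in atTop, ENNReal.ofReal (Real.exp (-(n * b))) ≤ P n (Y n ⁻¹' U)) :
    SatisfiesGoodLDP P Y I := by
  have hn0 : ∀ n : ℕ, (0 : EReal) ≤ (n : EReal) := fun n => by positivity
  refine ⟨hclosed, hcompact, fun F hF => ?_, fun U hU => ?_⟩
  · refine le_of_forall_gt_imp_ge_of_dense fun y hy => ?_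
    -- A nonnegative level is trivial for probabilities. Below zero, two reals are inserted between
    -- `-y` and the infimum, which also covers an infinite infimum.
    rcases le_or_gt 0 y with hy0 | hy0
    · refine limsup_le_of_le (by isBoundedDefault) ?_
      filter_upwards [hone F] with n hn
      refine le_trans ?_ hy0
      have h1 : ENNReal.log (P n (Y n ⁻¹' F)) ≤ 0 := ENNReal.log_le_zero_iff.2 hn
      have h2 := EReal.div_le_div_right_of_nonneg (hn0 n) h1
      rwa [EReal.zero_div] at h2
    · have hz : (((-y).toENNReal : ℝ≥0∞) : EReal) = -y :=
        EReal.coe_toENNReal (EReal.neg_nonneg.2 hy0.le)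
      have hlt : (-y).toENNReal < ⨅ x ∈ F, I x := by
        rw [← EReal.coe_ennreal_lt_coe_ennreal_iff, hz]
        exact EReal.neg_lt_comm.1 hy
      obtain ⟨b, hb1, hb2⟩ := ENNReal.lt_iff_exists_nnreal_btwn.1 hlt
      obtain ⟨a, ha1, ha2⟩ := ENNReal.lt_iff_exists_nnreal_btwn.1 hb2
      refine limsup_le_of_le (by isBoundedDefault) ?_
      filter_upwards [hupper F hF a b (by exact_mod_cast ha1)
        (fun x hx => ha2.trans_le (iInf₂_le x hx)), eventually_ge_atTop 1] with n hn hn1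
      have h2 := EReal.div_le_div_right_of_nonneg (hn0 n) (ENNReal.log_le_log hn)
      rw [log_ofReal_exp_div n hn1] at h2
      refine h2.trans ?_
      rw [EReal.coe_neg, EReal.neg_le, ← hz]
      exact EReal.coe_ennreal_le_coe_ennreal_iff.2 hb1.le
  · refine le_of_forall_lt_imp_le_of_dense fun y hy => ?_
    have hy' : ((⨅ x ∈ U, I x : ℝ≥0∞) : EReal) < -y := EReal.lt_neg_comm.1 hy
    have hz : (((-y).toENNReal : ℝ≥0∞) : EReal) = -y :=
      EReal.coe_toENNReal ((EReal.coe_ennreal_nonneg _).trans hy'.le)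
    have hlt : ⨅ x ∈ U, I x < (-y).toENNReal := by
      rwa [← EReal.coe_ennreal_lt_coe_ennreal_iff, hz]
    obtain ⟨x, hx⟩ := iInf_lt_iff.1 hlt
    obtain ⟨hxU, hx⟩ := iInf_lt_iff.1 hx
    obtain ⟨b, hb1, hb2⟩ := ENNReal.lt_iff_exists_nnreal_btwn.1 hx
    refine le_liminf_of_le (by isBoundedDefault) ?_
    filter_upwards [hlower U hU x hxU b hb1, eventually_ge_atTop 1] with n hn hn1
    have h2 := EReal.div_le_div_right_of_nonneg (hn0 n) (ENNReal.log_le_log hn)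
    rw [log_ofReal_exp_div n hn1] at h2
    refine le_trans ?_ h2
    rw [EReal.coe_neg, EReal.le_neg, ← hz]
    exact EReal.coe_ennreal_le_coe_ennreal_iff.2 hb2.le

lemma law_preimage_le_one {d n m : ℕ} (hn : n ≠ 0) (A : Set (ProbabilityMeasure ℕ)) :
    law d n m (degreeDistribution ⁻¹' A) ≤ 1 := by
  rw [law_preimage hn]
  refine ENNReal.div_le_of_le_mul ?_
  rw [one_mul]
  classical
  exact_mod_cast Finset.card_filter_le _ _

lemma law_preimage_univ {d n m : ℕ} (hn : n ≠ 0) (hm : m ≤ n.choose 2) :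
    law d n m (degreeDistribution ⁻¹' Set.univ) = 1 := by
  have : (graphs n m).card ≠ 0 := by
    rw [card_graphs]
    exact (Nat.choose_pos hm).ne'
  rw [law_preimage hn]
  simp only [Set.mem_univ, Finset.filter_true]
  exact ENNReal.div_self (by exact_mod_cast this) (ENNReal.natCast_ne_top _)

/-! ### The case of mean zero -/

lemma mass_eq_zero_of_mean_eq_zero {δ : ProbabilityMeasure ℕ} (h : mean δ = 0) {r : ℕ}
    (hr : r ≠ 0) : mass δ r = 0 := by
  rw [mean_eq, ENNReal.tsum_eq_zero] at h
  have h1 := ENNReal.ofReal_eq_zero.1 (h r)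
  have hr : (0 : ℝ) < r := by positivity
  have := mass_nonneg δ r
  nlinarith

/-- The unit mass at `0`. -/
noncomputable def poissonZero : ProbabilityMeasure ℕ := ⟨poissonMeasure 0, inferInstance⟩

lemma mass_poissonZero (r : ℕ) : mass poissonZero r = if r = 0 then 1 else 0 := by
  have : mass poissonZero r = (poissonMeasure 0).real {r} := rfl
  rw [this, poissonMeasure_real_singleton]
  split_ifs with h
  · simp [h]
  · simp [h]

lemma eq_poissonZero {δ : ProbabilityMeasure ℕ} (h : ∀ r, r ≠ 0 → mass δ r = 0) :
    δ = poissonZero := by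
  refine ext_mass fun r => ?_
  rw [mass_poissonZero]
  split_ifs with hr
  · subst hr
    exact (hasSum_single 0 h).unique (hasSum_mass δ)
  · exact h r hr

lemma rate_zero_poissonZero : rate 0 poissonZero = 0 := by
  have h : mean poissonZero = 0 := by
    rw [mean_eq, ENNReal.tsum_eq_zero]
    intro r
    rw [mass_poissonZero]
    split_ifs with hr <;> simp [hr]
  unfold rate
  rw [if_pos (by simp [h]), h]
  exact InformationTheory.klDiv_self _

lemma eq_poissonZero_of_rate_ne_top {δ : ProbabilityMeasure ℕ} (h : rate 0 δ ≠ ∞) :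
    δ = poissonZero := by
  unfold rate at h
  split_ifs at h with h1
  have : mean δ = 0 := by
    rcases (ENNReal.toReal_eq_zero_iff _).1 h1.2 with h2 | h2
    · exact h2
    · exact absurd h2 h1.1
  exact eq_poissonZero fun r hr => mass_eq_zero_of_mean_eq_zero this hr
  exact absurd rfl h

lemma setOf_rate_zero_le (a : ℝ≥0) :
    {δ : ProbabilityMeasure ℕ | rate 0 δ ≤ a} = {poissonZero} := by
  ext δ
  constructor
  · intro h
    exact eq_poissonZero_of_rate_ne_top (ne_top_of_le_ne_top ENNReal.coe_ne_top h)
  · rintro rfl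
    change rate 0 poissonZero ≤ a
    rw [rate_zero_poissonZero]
    exact zero_le

lemma occ_add_sum_ge {n : ℕ} (d : Fin n → ℕ) : n ≤ occ d 0 + ∑ v, d v := by
  classical
  have h1 : occ d 0 = ∑ v, if d v = 0 then 1 else 0 := by
    rw [← Finset.card_filter]
    unfold occ
    congr
  rw [h1, ← Finset.sum_add_distrib]
  calc n = ∑ _v : Fin n, 1 := by simp
    _ ≤ _ := Finset.sum_le_sum fun v _ => by split_ifs <;> omega

/-- At most `∑ v, d v` entries are nonzero, so all masses away from `0` together are at most this
sum over `n`. -/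
lemma abs_mass_empirical_sub_le {n : ℕ} (hn : n ≠ 0) (d : Fin n → ℕ) (r : ℕ) :
    |mass (empirical hn d) r - mass poissonZero r| ≤ ((∑ v, d v : ℕ) : ℝ) / n := by
  have hn' : (0 : ℝ) < n := by positivity
  have h0 : 1 - mass (empirical hn d) 0 ≤ ((∑ v, d v : ℕ) : ℝ) / n := by
    rw [mass_empirical, sub_le_iff_le_add, ← add_div, le_div_iff₀ hn', one_mul]
    have := occ_add_sum_ge d
    rw [add_comm] at this
    exact_mod_cast this
  rw [mass_poissonZero]
  split_ifs with hr
  · subst hr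
    rw [abs_sub_comm, abs_of_nonneg (sub_nonneg.2 (mass_le_one _ _))]
    exact h0
  · rw [sub_zero, abs_of_nonneg (mass_nonneg _ _)]
    refine le_trans ?_ h0
    have h1 := sum_le_hasSum {0, r} (fun r _ => mass_nonneg (empirical hn d) r)
      (hasSum_mass (empirical hn d))
    rw [Finset.sum_pair (Ne.symm hr)] at h1
    linarith

/-- A sure statement: every word has degree sum `2m = o(n)`, so its distribution lies in the given
neighbourhood once `n` is large. -/
lemma eventually_law_preimage_eq_zero {lam : ℕ → ℕ}
    (hlam : Tendsto (fun n : ℕ => (lam n : ℝ) / n) atTop (𝓝 (0 / 2))) (d : ℕ)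
    {A : Set (ProbabilityMeasure ℕ)} (hA : Aᶜ ∈ 𝓝 poissonZero) :
    ∀ᶠ n : ℕ in atTop, law d n (lam n) (degreeDistribution ⁻¹' A) = 0 := by
  classical
  obtain ⟨ε, hε, s, hs⟩ := exists_forall_abs_mass_sub_lt hA
  filter_upwards [(tendsto_two_mul_div hlam).eventually (gt_mem_nhds hε),
    eventually_le_choose hlam, eventually_ge_atTop 1] with n hn hch hn1
  have hn0 : n ≠ 0 := by omega
  refine le_antisymm ((law_preimage_le hn0 hch A).trans (le_of_eq ?_)) zero_le
  have : (Finset.univ.filter fun a : Fin (lam n) × Bool → Fin n =>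
      empirical hn0 (occ a) ∈ A) = ∅ := by
    rw [Finset.filter_eq_empty_iff]
    intro a _
    refine hs _ fun r _ => (abs_mass_empirical_sub_le hn0 (occ a) r).trans_lt ?_
    rw [sum_occ]
    simpa [mul_comm] using hn
  rw [this]
  simp

lemma satisfiesGoodLDP_zero (d : ℕ) {lam : ℕ → ℕ}
    (hlam : Tendsto (fun n : ℕ => (lam n : ℝ) / n) atTop (𝓝 (0 / 2))) :
    SatisfiesGoodLDP (fun n : ℕ => law d n (lam n))
      (fun n : ℕ => degreeDistribution (d := d) (n := n)) (rate 0) := by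
  refine satisfiesGoodLDP_of_eventually (fun a => ?_) (fun a => ?_) (fun F => ?_)
    (fun F hF a b _ ha => ?_) (fun U hU δ hδ b hb => ?_)
  · rw [setOf_rate_zero_le]
    exact isClosed_singleton
  · rw [setOf_rate_zero_le]
    exact isCompact_singleton
  · filter_upwards [eventually_ne_atTop 0] with n hn
    exact law_preimage_le_one hn F
  · have : poissonZero ∈ Fᶜ := fun h => by
      have := ha _ h
      rw [rate_zero_poissonZero] at this
      exact not_lt_zero this
    filter_upwards [eventually_law_preimage_eq_zero hlam d (hF.isOpen_compl.mem_nhds this)]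
      with n hn
    rw [hn]
    exact zero_le
  · have := eq_poissonZero_of_rate_ne_top hb.ne_top
    subst this
    have hU' : Uᶜᶜ ∈ 𝓝 poissonZero := by
      rw [compl_compl]
      exact hU.mem_nhds hδ
    filter_upwards [eventually_law_preimage_eq_zero hlam d hU', eventually_le_choose hlam,
      eventually_ne_atTop 0] with n hn hch hn0
    have h1 : ENNReal.ofReal (Real.exp (-(n * b))) ≤ 1 := by
      rw [ENNReal.ofReal_le_one, Real.exp_le_one_iff]
      have : (0 : ℝ) ≤ n * b := by positivity
      linarith
    refine h1.trans ?_
    rw [← law_preimage_univ (d := d) hn0 hch, ← Set.union_compl_self U, Set.preimage_union]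
    refine (measure_union_le _ _).trans ?_
    rw [hn, add_zero]

lemma satisfiesGoodLDP_pos (d : ℕ) {c : ℝ} (hc : 0 < c) {lam : ℕ → ℕ}
    (hlam : Tendsto (fun n : ℕ => (lam n : ℝ) / n) atTop (𝓝 (c / 2))) :
    SatisfiesGoodLDP (fun n : ℕ => law d n (lam n))
      (fun n : ℕ => degreeDistribution (d := d) (n := n)) (rate c) := by
  refine satisfiesGoodLDP_of_eventually (isClosed_rate_le hc) (isCompact_rate_le hc) (fun F => ?_)
    (fun F hF a b hba ha => eventually_law_le_exp hc hlam d hF hba ha)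
    (fun U hU δ hδ b hb => eventually_exp_le_law hc hlam d hU hδ hb)
  filter_upwards [eventually_ne_atTop 0] with n hn
  exact law_preimage_le_one hn F

end RandomGeometricGraph

theorem mainTheorem2 (d : ℕ) (t : ℝ) (lam : ℕ → ℕ)
    (hlam : Tendsto (fun n : ℕ => (lam n : ℝ) / (n : ℝ)) atTop
      (𝓝 (RandomGeometricGraph.rho d * t / 2))) :
    RandomGeometricGraph.SatisfiesGoodLDP
      (fun n : ℕ => RandomGeometricGraph.law d n (lam n))
      (fun n : ℕ => RandomGeometricGraph.degreeDistribution (d := d) (n := n))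
      (RandomGeometricGraph.rate (RandomGeometricGraph.rho d * t)) := by
  have h0 : 0 ≤ RandomGeometricGraph.rho d * t := by
    have := ge_of_tendsto' hlam fun n => (by positivity : (0 : ℝ) ≤ (lam n : ℝ) / n)
    linarith
  -- The factor `rho d` and `t` matter only through the limit `c ≥ 0` of `2m/n`. The case `c = 0` is
  -- separate, since entropy with respect to a Poisson law of positive mean is then unavailable.
  generalize RandomGeometricGraph.rho d * t = c at hlam h0 ⊢
  rcases h0.eq_or_lt with rfl | hc
  · exact RandomGeometricGraph.satisfiesGoodLDP_zero d hlam
  · exact RandomGeometricGraph.satisfiesGoodLDP_pos d hc hlam
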